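/- \textbf{Setting.} Let $p,q\ge 1$ and let $Z_1,Z_2,\dots$ be i.i.d. copies of a random matrix $Z=(z_{kl})\in\mathbb R^{p\times q}$ with $E|z_{kl}|^8<\infty$ for all $k,l$, whose components $z_{kl}$ are mutually independent with $E(z_{kl})=0$ and $\mathrm{var}(z_{kl})=1$. Write $\gamma_{kl}=E(z_{kl}^3)$, $\beta_{kl}=E(z_{kl}^4)$, $\bar\beta_{k\cdot}=\frac1q\sum_l\beta_{kl}$ and $\bar\beta_{\cdot l}=\frac1p\sum_k\beta_{kl}$. Assume that $\bar\beta_{1\cdot},\dots,\bar\beta_{p\cdot}$ are distinct and that $\bar\beta_{\cdot1},\dots,\bar\beta_{\cdot q}$ are distinct. Identity mixing means that the observations are the $Z_i$ themselves. \textbf{Estimates.} Let $\bar Z=\frac1n\sum_{i=1}^nZ_i$, and let the sample covariance matrices be $$\bar S_L=\frac1{qn}\sum_{i=1}^n(Z_i-C)(Z_i-C)^\top,\qquad \bar S_R=\frac1{pn}\sum_{i=1}^n(Z_i-C)^\top(Z_i-C),$$ where either $C=0$ or $C=\bar Z$ throughout. When $\bar S_L,\bar S_R$ are positive definite, let $L=\bar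 S_L^{-1/2}$ and $R=\bar S_R^{-1/2}$ be their symmetric (positive definite) inverse square roots, put $Y_i=L(Z_i-\bar Z)R^\top$ and $$\bar B^0_L=\frac1{qn}\sum_{i=1}^nY_iY_i^\top Y_iY_i^\top,\qquad \bar B^1_L=\frac1{qn}\sum_{i=1}^n\|Y_i\|_F^2\,Y_iY_i^\top .$$ For $N\in\{0,1\}$, a \emph{left MFOBI estimate} is any matrix $\hat W^\top L$ with $\hat W$ orthogonal and $\bar B_L^N=\hat W\hat\Lambda\hat W^\top$ for some diagonal $\hat\Lambda$ (order and signs of the eigenvectors are free). \textbf{Averaged cross-moments.} Let $z_{i,kl}$ be the entries of $Z_i$. For row indices $k,k',m$ put $$\bar s_{kk'}=\frac1{q}\sum_l\frac1n\sum_i z_{i,kl}z_{i,k'l},\quad \bar q_{kk'}=\frac1q\sum_l\frac1n\sum_i(z_{i,kl}^3-\gamma_{kl})z_{i,k'l},\quad \bar q_{mkk'}=\frac1q\sum_l\frac1n\sum_i z_{i,ml}^2z_{i,kl}z_{i,k'l},$$ $$\bar r_{kk'}=\frac1q\sum_l\sum_{l'\ne l}\frac1n\sum_i z_{i,kl}^2z_{i,kl'}z_{i,k'l'},\quad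 \bar r^0_{mkk'}=\frac1q\sum_l\sum_{l'\neq l}\frac1n\sum_i z_{i,kl}z_{i,ml}z_{i,ml'}z_{i,k'l'},\quad \bar r^1_{mkk'}=\frac1q\sum_l\sum_{l'\neq l}\frac1n\sum_i z_{i,ml}^2z_{i,kl'}z_{i,k'l'},$$ and, for $k\ne k'$, $\bar Q=\bar q_{kk'}+\bar q_{k'k}+\sum_{m\ne k,k'}\bar q_{mkk'}$ and $\bar R^N=\bar r_{kk'}+\bar r_{k'k}+\sum_{m\neq k,k'}\bar r^N_{mkk'}$. Let $b_0=2q+p-1$ and $b_1=qp+1$. \textbf{Theorem.} For each $N\in\{0,1\}$ and each of the two choices of $C$, $\bar S_L$ and $\bar S_R$ are positive definite with probability tending to one, and there is a sequence $\hat\Gamma=\hat\Gamma_n=(\hat\gamma_{kk'})$ of measurable functions of $(Z_1,\dots,Z_n)$ that are left MFOBI estimates whenever $\bar S_L$ and $\bar S_R$ are positive definite, such that $\hat\Gamma\to_P I_p$ and, as $n\to\infty$, $$\sqrt n(\hat\gamma_{kk}-1)=-\tfrac12\sqrt n(\bar s_{kk}-1)+o_P(1),$$ $$\sqrt n\,\hat\gamma_{kk'}=\frac{\sqrt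 n\,\bar Q+\sqrt n\,\bar R^N-(\bar\beta_{k\cdot}+b_N)\sqrt n\,\bar s_{kk'}}{\bar\beta_{k\cdot}-\bar\beta_{k'\cdot}}+o_P(1),\qquad k\ne k'.$$ -/

import Mathlib

open MeasureTheory ProbabilityTheory Filter Matrix
open scoped Topology

noncomputable section

namespace MFOBI

/-- Real matrices carry the product sigma-algebra, that is, the Borel sigma-algebra of
`ℝ^(m × n)`. -/
instance instMeasurableSpaceMatrix {m n : Type*} : MeasurableSpace (Matrix m n ℝ) :=
  inferInstanceAs (MeasurableSpace (m → n → ℝ))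

/-! ### Population moments of a random matrix -/

section Population

variable {Ω : Type*} [MeasurableSpace Ω] {p q : ℕ}

/-- The third moment `γ_{kl} = E (z_{kl}^3)`. -/
def skew (P : Measure Ω) (Z : Ω → Matrix (Fin p) (Fin q) ℝ) (k : Fin p) (l : Fin q) : ℝ :=
  ∫ ω, Z ω k l ^ 3 ∂P

/-- The fourth moment `β_{kl} = E (z_{kl}^4)`. -/
def kurt (P : Measure Ω) (Z : Ω → Matrix (Fin p) (Fin q) ℝ) (k : Fin p) (l : Fin q) : ℝ :=
  ∫ ω, Z ω k l ^ 4 ∂P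

/-- The row average of the kurtoses, `(1/q) ∑_l β_{kl}`. -/
def rowKurt (P : Measure Ω) (Z : Ω → Matrix (Fin p) (Fin q) ℝ) (k : Fin p) : ℝ :=
  (1 / (q : ℝ)) * ∑ l, kurt P Z k l

/-- The column average of the kurtoses, `(1/p) ∑_k β_{kl}`. -/
def colKurt (P : Measure Ω) (Z : Ω → Matrix (Fin p) (Fin q) ℝ) (l : Fin q) : ℝ :=
  (1 / (p : ℝ)) * ∑ k, kurt P Z k l

/-- The components of `Z` are mutually independent, with mean zero and variance one. -/
structure StandardizedIndependent (P : Measure Ω) (Z : Ω → Matrix (Fin p) (Fin q) ℝ) : Prop where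
  indep : iIndepFun (fun (kl : Fin p × Fin q) (ω : Ω) => Z ω kl.1 kl.2) P
  mean_zero : ∀ k l, ∫ ω, Z ω k l ∂P = 0
  variance_one : ∀ k l, variance (fun ω => Z ω k l) P = 1

/-- The row averages of the kurtoses are distinct, and so are the column averages. -/
def DistinctKurtoses (P : Measure Ω) (Z : Ω → Matrix (Fin p) (Fin q) ℝ) : Prop :=
  Function.Injective (rowKurt P Z) ∧ Function.Injective (colKurt P Z)

end Population

/-! ### The left estimate computed from a sample `x 0, …, x (n - 1)` -/

section Sample

variable {n p q : ℕ}

/-- The sample mean matrix. -/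
def sampleMean (x : Fin n → Matrix (Fin p) (Fin q) ℝ) : Matrix (Fin p) (Fin q) ℝ :=
  (1 / (n : ℝ)) • ∑ i, x i

/-- The location that is subtracted before the sample covariance matrices are computed: the sample
mean if `c = true`, and the known population mean zero if `c = false`. -/
def location (c : Bool) (x : Fin n → Matrix (Fin p) (Fin q) ℝ) : Matrix (Fin p) (Fin q) ℝ :=
  if c then sampleMean x else 0

/-- The sample left covariance matrix. -/
def leftCov (c : Bool) (x : Fin n → Matrix (Fin p) (Fin q) ℝ) : Matrix (Fin p) (Fin p) ℝ :=
  (1 / (q : ℝ)) • (1 / (n : ℝ)) • ∑ i, (x i - location c x) * (x i - location c x)ᵀ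

/-- The sample right covariance matrix. -/
def rightCov (c : Bool) (x : Fin n → Matrix (Fin p) (Fin q) ℝ) : Matrix (Fin q) (Fin q) ℝ :=
  (1 / (p : ℝ)) • (1 / (n : ℝ)) • ∑ i, (x i - location c x)ᵀ * (x i - location c x)

/-- `G` is the symmetric inverse square root of `S`: for a positive definite `S = U D Uᵀ` it is the
matrix `U D^(-1/2) Uᵀ`, the only positive definite `G` with `G S Gᵀ = I`. -/
def IsSymmInvSqrt {r : ℕ} (G S : Matrix (Fin r) (Fin r) ℝ) : Prop :=
  G.PosDef ∧ G * S * Gᵀ = 1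

/-- The integrand of the FOBI functional: `Y Yᵀ Y Yᵀ` for `N = 0` and `‖Y‖_F² Y Yᵀ` for
`N = 1`. -/
def fobiKernel (N : Fin 2) (Y : Matrix (Fin p) (Fin q) ℝ) : Matrix (Fin p) (Fin p) ℝ :=
  if N = 0 then Y * Yᵀ * Y * Yᵀ else (∑ k, ∑ l, Y k l ^ 2) • (Y * Yᵀ)

/-- The sample left FOBI matrix, computed from the centred observations standardized by `L` on the
left and by `R` on the right. -/
def leftFobi (N : Fin 2) (L : Matrix (Fin p) (Fin p) ℝ) (R : Matrix (Fin q) (Fin q) ℝ)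
    (x : Fin n → Matrix (Fin p) (Fin q) ℝ) : Matrix (Fin p) (Fin p) ℝ :=
  (1 / (q : ℝ)) • (1 / (n : ℝ)) • ∑ i, fobiKernel N (L * (x i - sampleMean x) * Rᵀ)

/-- `G` is a left MFOBI estimate for the sample `x`: `G = Wᵀ L`, where `L` and `R` are the symmetric
inverse square roots of the left and right sample covariance matrices and the columns of the
orthogonal matrix `W` are eigenvectors of the sample left FOBI matrix. The order and the signs of
the columns of `W` are free. -/
def IsLeftEstimate (N : Fin 2) (c : Bool) (x : Fin n → Matrix (Fin p) (Fin q) ℝ)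
    (G : Matrix (Fin p) (Fin p) ℝ) : Prop :=
  ∃ (L : Matrix (Fin p) (Fin p) ℝ) (R : Matrix (Fin q) (Fin q) ℝ) (W : Matrix (Fin p) (Fin p) ℝ)
    (d : Fin p → ℝ),
    IsSymmInvSqrt L (leftCov c x) ∧ IsSymmInvSqrt R (rightCov c x) ∧
      W ∈ Matrix.orthogonalGroup (Fin p) ℝ ∧
      leftFobi N L R x = W * Matrix.diagonal d * Wᵀ ∧ G = Wᵀ * L

/-! ### The averaged cross-moment estimates -/

def sBar (x : Fin n → Matrix (Fin p) (Fin q) ℝ) (k k' : Fin p) : ℝ :=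
  (1 / (q : ℝ)) * ∑ l, (1 / (n : ℝ)) * ∑ i, x i k l * x i k' l

/-- `q̄_{kk'}`; the argument `g` is the matrix of third moments `γ_{kl}`. -/
def qBar (g : Fin p → Fin q → ℝ) (x : Fin n → Matrix (Fin p) (Fin q) ℝ) (k k' : Fin p) : ℝ :=
  (1 / (q : ℝ)) * ∑ l, (1 / (n : ℝ)) * ∑ i, (x i k l ^ 3 - g k l) * x i k' l

/-- `q̄_{mkk'}`. -/
def qBar₃ (x : Fin n → Matrix (Fin p) (Fin q) ℝ) (m k k' : Fin p) : ℝ :=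
  (1 / (q : ℝ)) * ∑ l, (1 / (n : ℝ)) * ∑ i, x i m l ^ 2 * x i k l * x i k' l

/-- `r̄_{kk'}`. -/
def rBar (x : Fin n → Matrix (Fin p) (Fin q) ℝ) (k k' : Fin p) : ℝ :=
  (1 / (q : ℝ)) * ∑ l, ∑ l' ∈ Finset.univ.erase l,
    (1 / (n : ℝ)) * ∑ i, x i k l ^ 2 * x i k l' * x i k' l'

/-- `r̄^N_{mkk'}`. -/
def rBar₃ (N : Fin 2) (x : Fin n → Matrix (Fin p) (Fin q) ℝ) (m k k' : Fin p) : ℝ :=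
  if N = 0 then
    (1 / (q : ℝ)) * ∑ l, ∑ l' ∈ Finset.univ.erase l,
      (1 / (n : ℝ)) * ∑ i, x i k l * x i m l * x i m l' * x i k' l'
  else
    (1 / (q : ℝ)) * ∑ l, ∑ l' ∈ Finset.univ.erase l,
      (1 / (n : ℝ)) * ∑ i, x i m l ^ 2 * x i k l' * x i k' l'

/-- `Q̄ = q̄_{kk'} + q̄_{k'k} + ∑_{m ≠ k, k'} q̄_{mkk'}`. -/
def QBar (g : Fin p → Fin q → ℝ) (x : Fin n → Matrix (Fin p) (Fin q) ℝ) (k k' : Fin p) : ℝ :=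
  qBar g x k k' + qBar g x k' k + ∑ m ∈ (Finset.univ.erase k).erase k', qBar₃ x m k k'

/-- `R̄^N = r̄_{kk'} + r̄_{k'k} + ∑_{m ≠ k, k'} r̄^N_{mkk'}`. -/
def RBar (N : Fin 2) (x : Fin n → Matrix (Fin p) (Fin q) ℝ) (k k' : Fin p) : ℝ :=
  rBar x k k' + rBar x k' k + ∑ m ∈ (Finset.univ.erase k).erase k', rBar₃ N x m k k'

/-- `b_0 = 2q + p - 1` and `b_1 = qp + 1`. -/
def bConst (N : Fin 2) (p q : ℕ) : ℝ :=
  if N = 0 then 2 * (q : ℝ) + (p : ℝ) - 1 else (q : ℝ) * (p : ℝ) + 1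

end Sample

/-- The first `n` observations of a sequence of random matrices, at the outcome `ω`. -/
def firstObs {Ω : Type*} {p q : ℕ} (Z : ℕ → Ω → Matrix (Fin p) (Fin q) ℝ) (n : ℕ) (ω : Ω) :
    Fin n → Matrix (Fin p) (Fin q) ℝ :=
  fun i => Z i ω

end MFOBI

end

namespace MFOBI

/-! ### Measurable selection from compact-valued correspondences -/

section Selection

variable {X K : Type*} [MeasurableSpace X] [TopologicalSpace K]

/-- The correspondence `F` has measurable hitting sets of closed sets. -/
def HitsMeasurably (F : X → Set K) : Prop :=
  ∀ C : Set K, IsClosed C → MeasurableSet {x | (F x ∩ C).Nonempty}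

/-- The points of `s` at which `f` attains its minimum over `s`. -/
def minimizers (f : K → ℝ) (s : Set K) : Set K :=
  {w | w ∈ s ∧ ∀ v ∈ s, f w ≤ f v}

theorem minimizers_subset {K : Type*} (f : K → ℝ) (s : Set K) : minimizers f s ⊆ s := fun _ h => h.1

theorem minimizers_nonempty {f : K → ℝ} (hf : Continuous f) {s : Set K} (hs : IsCompact s)
    (hne : s.Nonempty) : (minimizers f s).Nonempty := by
  obtain ⟨w, hw, hmin⟩ := hs.exists_isMinOn hne hf.continuousOn
  exact ⟨w, hw, fun v hv => hmin hv⟩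

theorem isCompact_minimizers {f : K → ℝ} (hf : Continuous f) {s : Set K} (hs : IsCompact s) :
    IsCompact (minimizers f s) := by
  have : minimizers f s = s ∩ ⋂ v ∈ s, {w | f w ≤ f v} := by
    ext w; simp [minimizers]
  rw [this]
  exact hs.inter_right (isClosed_biInter fun v _ => isClosed_le hf continuous_const)

theorem HitsMeasurably.minimizers {F : X → Set K} (hF : HitsMeasurably F)
    (hc : ∀ x, IsCompact (F x)) {f : K → ℝ} (hf : Continuous f) :
    HitsMeasurably fun x => minimizers f (F x) := by
  intro C hC
  have hcl : ∀ r : ℚ, IsClosed {w | f w ≤ (r : ℝ)} := fun r => isClosed_le hf continuous_const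
  have key : {x | (MFOBI.minimizers f (F x) ∩ C).Nonempty} =
      {x | (F x ∩ C).Nonempty} \ ⋃ r : ℚ, ({x | (F x ∩ {w | f w ≤ (r : ℝ)}).Nonempty} \
        {x | (F x ∩ (C ∩ {w | f w ≤ (r : ℝ)})).Nonempty}) := by
    ext x
    simp only [Set.mem_ofPred_eq, Set.mem_sdiff, Set.mem_iUnion, not_exists, not_and, not_not]
    constructor
    · rintro ⟨w, ⟨hw, hmin⟩, hwC⟩
      refine ⟨⟨w, hw, hwC⟩, ?_⟩
      rintro r ⟨v, hv, hvr⟩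
      exact ⟨w, hw, hwC, (hmin v hv).trans hvr⟩
    · rintro ⟨hne, hr⟩
      obtain ⟨w, hw, hmin⟩ := ((hc x).inter_right hC).exists_isMinOn hne hf.continuousOn
      refine ⟨w, ⟨hw.1, fun v hv => ?_⟩, hw.2⟩
      by_contra! hlt
      obtain ⟨r, hr1, hr2⟩ := exists_rat_btwn hlt
      obtain ⟨u, hu, huC, hur⟩ := hr r ⟨v, hv, hr1.le⟩
      have h1 : f w ≤ f u := hmin ⟨hu, huC⟩
      have h2 : f u ≤ r := hur
      linarith
  rw [key]
  exact (hF C hC).diff (MeasurableSet.iUnion fun r =>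
    (hF _ (hcl r)).diff (hF _ (hC.inter (hcl r))))

theorem HitsMeasurably.exists_refinement (fs : List (K → ℝ)) (hfs : ∀ f ∈ fs, Continuous f)
    {F : X → Set K} (hF : HitsMeasurably F) (hc : ∀ x, IsCompact (F x))
    (hne : ∀ x, (F x).Nonempty) :
    ∃ F' : X → Set K, HitsMeasurably F' ∧ (∀ x, IsCompact (F' x)) ∧ (∀ x, (F' x).Nonempty) ∧
      (∀ x, F' x ⊆ F x) ∧ ∀ f ∈ fs, ∀ x, ∀ v ∈ F' x, ∀ w ∈ F' x, f v = f w := by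
  induction fs generalizing F with
  | nil => exact ⟨F, hF, hc, hne, fun _ => subset_rfl, by simp⟩
  | cons f fs ih =>
    have hf : Continuous f := hfs f (by simp)
    obtain ⟨F', h1, h2, h3, h4, h5⟩ := ih (fun g hg => hfs g (by simp [hg]))
      (hF.minimizers hc hf) (fun x => isCompact_minimizers hf (hc x))
      (fun x => minimizers_nonempty hf (hc x) (hne x))
    refine ⟨F', h1, h2, h3, fun x => (h4 x).trans (minimizers_subset _ _), ?_⟩
    intro g hg x v hv w hw
    rcases List.mem_cons.1 hg with rfl | hg
    · exact le_antisymm ((h4 x hv).2 w (h4 x hw).1) ((h4 x hw).2 v (h4 x hv).1)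
    · exact h5 g hg x v hv w hw

/-- A measurable selection that minimizes a prescribed continuous function. -/
theorem HitsMeasurably.exists_measurable_selection [MeasurableSpace K] [BorelSpace K]
    (fs : List (K → ℝ)) (hfs : ∀ f ∈ fs, Continuous f)
    (hsep : ∀ v w : K, (∀ f ∈ fs, f v = f w) → v = w) {f₀ : K → ℝ} (hf₀ : Continuous f₀)
    {F : X → Set K} (hF : HitsMeasurably F) (hc : ∀ x, IsCompact (F x))
    (hne : ∀ x, (F x).Nonempty) :
    ∃ w : X → K, Measurable w ∧ ∀ x, w x ∈ MFOBI.minimizers f₀ (F x) := by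
  obtain ⟨F', h1, -, h3, h4, h5⟩ := (hF.minimizers hc hf₀).exists_refinement fs hfs
    (fun x => isCompact_minimizers hf₀ (hc x)) (fun x => minimizers_nonempty hf₀ (hc x) (hne x))
  choose w hw using h3
  refine ⟨w, measurable_of_isClosed fun C hC => ?_, fun x => h4 x (hw x)⟩
  have : w ⁻¹' C = {x | (F' x ∩ C).Nonempty} := by
    ext x
    constructor
    · intro h
      exact ⟨w x, hw x, h⟩
    · rintro ⟨v, hv, hvC⟩
      have : w x = v := hsep _ _ fun f hf => h5 f hf x _ (hw x) _ hv
      simpa [this] using hvC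
  rw [this]
  exact h1 C hC

/-- A correspondence with closed graph and values in a fixed compact set has measurable hitting
sets. -/
theorem HitsMeasurably.of_isClosed_graph [TopologicalSpace X] [OpensMeasurableSpace X]
    {F : X → Set K} {S : Set K} (hS : IsCompact S) (hsub : ∀ x, F x ⊆ S)
    (hgraph : IsClosed {z : X × K | z.2 ∈ F z.1}) : HitsMeasurably F := by
  intro C hC
  apply IsClosed.measurableSet
  have : CompactSpace S := isCompact_iff_compactSpace.1 hS
  have h := isClosedMap_fst_of_compactSpace (X := X) (Y := S)
    {z : X × S | (z.2 : K) ∈ F z.1 ∧ (z.2 : K) ∈ C} (by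
      apply IsClosed.inter
      · exact hgraph.preimage (f := fun z : X × S => (z.1, (z.2 : K))) (by fun_prop)
      · exact hC.preimage (f := fun z : X × S => (z.2 : K)) (by fun_prop))
  convert h using 1
  ext x
  constructor
  · rintro ⟨w, hw, hwC⟩
    exact ⟨(x, ⟨w, hsub x hw⟩), ⟨hw, hwC⟩, rfl⟩
  · rintro ⟨⟨y, w⟩, ⟨h1, h2⟩, rfl⟩
    exact ⟨w, h1, h2⟩

end Selection

/-! ### Measurable eigenvectors of symmetric matrices -/

section Eigen

variable {r : ℕ}

instance instBorelSpaceMatrix {m n : Type*} [Finite m] [Finite n] : BorelSpace (Matrix m n ℝ) :=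
  inferInstanceAs (BorelSpace (m → n → ℝ))

theorem abs_le_one_of_mul_transpose {W : Matrix (Fin r) (Fin r) ℝ} (hW : W * Wᵀ = 1)
    (i j : Fin r) : |W i j| ≤ 1 := by
  have h : ∑ j, W i j * W i j = 1 := by
    have := congrFun (congrFun hW i) i
    simpa [Matrix.mul_apply] using this
  have h2 : W i j * W i j ≤ ∑ j, W i j * W i j :=
    Finset.single_le_sum (f := fun j => W i j * W i j) (fun j _ => mul_self_nonneg _)
      (Finset.mem_univ j)
  rw [abs_le_one_iff_mul_self_le_one]
  linarith

theorem isCompact_orthogonal :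
    IsCompact {W : Matrix (Fin r) (Fin r) ℝ | W * Wᵀ = 1} := by
  have hbox : IsCompact {W : Matrix (Fin r) (Fin r) ℝ | ∀ i j, W i j ∈ Set.Icc (-1 : ℝ) 1} := by
    have h := isCompact_univ_pi (X := fun _ : Fin r => Fin r → ℝ)
      (s := fun _ => {v | ∀ j, v j ∈ Set.Icc (-1 : ℝ) 1}) (fun _ => by
        have h' := isCompact_univ_pi (X := fun _ : Fin r => ℝ)
          (s := fun _ => Set.Icc (-1 : ℝ) 1) (fun _ => isCompact_Icc)
        have he : {v : Fin r → ℝ | ∀ j, v j ∈ Set.Icc (-1 : ℝ) 1} =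
            Set.univ.pi fun _ => Set.Icc (-1 : ℝ) 1 := by
          ext v; simp only [Set.mem_pi, Set.mem_univ, forall_const, Set.mem_ofPred_eq]
        rw [he]; exact h')
    have he : {W : Matrix (Fin r) (Fin r) ℝ | ∀ i j, W i j ∈ Set.Icc (-1 : ℝ) 1} =
        Set.univ.pi fun _ : Fin r => {v : Fin r → ℝ | ∀ j, v j ∈ Set.Icc (-1 : ℝ) 1} := by
      ext v
      exact ⟨fun hv i _ => hv i, fun hv i => hv i (Set.mem_univ i)⟩
    rw [he]; exact h
  refine hbox.of_isClosed_subset (isClosed_eq (by fun_prop) continuous_const) ?_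
  intro W hW i j
  exact abs_le.1 (abs_le_one_of_mul_transpose hW i j)

/-- The symmetric part of a square matrix. -/
noncomputable def symmPart (B : Matrix (Fin r) (Fin r) ℝ) : Matrix (Fin r) (Fin r) ℝ := (1 / 2 : ℝ) • (B + Bᵀ)

theorem symmPart_transpose (B : Matrix (Fin r) (Fin r) ℝ) : (symmPart B)ᵀ = symmPart B := by
  simp [symmPart, add_comm]

theorem symmPart_of_symm {B : Matrix (Fin r) (Fin r) ℝ} (hB : Bᵀ = B) : symmPart B = B := by
  rw [symmPart, hB, ← two_smul ℝ B, smul_smul]; norm_num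

/-- The orthogonal matrices that diagonalize the symmetric part of `B`. -/
def diagonalizers (B : Matrix (Fin r) (Fin r) ℝ) : Set (Matrix (Fin r) (Fin r) ℝ) :=
  {W | W * Wᵀ = 1 ∧ ∀ i j, i ≠ j → (Wᵀ * symmPart B * W) i j = 0}

theorem diagonalizers_nonempty (B : Matrix (Fin r) (Fin r) ℝ) : (diagonalizers B).Nonempty := by
  have hB : (symmPart B).IsHermitian := by
    rw [Matrix.IsHermitian, Matrix.conjTranspose_eq_transpose_of_trivial, symmPart_transpose]
  have h := hB.spectral_theorem
  set U := hB.eigenvectorUnitary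
  have h1 : (U : Matrix (Fin r) (Fin r) ℝ) * (U : Matrix (Fin r) (Fin r) ℝ)ᵀ = 1 := by
    have := Unitary.coe_mul_star_self U
    simpa [Matrix.star_eq_conjTranspose, Matrix.conjTranspose_eq_transpose_of_trivial] using this
  have h2 : (U : Matrix (Fin r) (Fin r) ℝ)ᵀ * (U : Matrix (Fin r) (Fin r) ℝ) = 1 :=
    mul_eq_one_comm.1 h1
  refine ⟨U, h1, fun i j hij => ?_⟩
  have h3 : symmPart B = (U : Matrix (Fin r) (Fin r) ℝ) * diagonal hB.eigenvalues *
      (U : Matrix (Fin r) (Fin r) ℝ)ᵀ := by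
    conv_lhs => rw [h]
    rw [Unitary.conjStarAlgAut_apply]
    simp [Matrix.star_eq_conjTranspose, Matrix.conjTranspose_eq_transpose_of_trivial]
  have h4 : (U : Matrix (Fin r) (Fin r) ℝ)ᵀ * symmPart B * U = diagonal hB.eigenvalues := by
    calc _ = (U : Matrix (Fin r) (Fin r) ℝ)ᵀ * ((U : Matrix (Fin r) (Fin r) ℝ) *
          diagonal hB.eigenvalues * (U : Matrix (Fin r) (Fin r) ℝ)ᵀ) * U := by
          simp only [← h3]
      _ = ((U : Matrix (Fin r) (Fin r) ℝ)ᵀ * U) * diagonal hB.eigenvalues *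
        ((U : Matrix (Fin r) (Fin r) ℝ)ᵀ * U) := by simp only [Matrix.mul_assoc]
      _ = _ := by rw [h2]; simp
  rw [h4, Matrix.diagonal_apply_ne _ hij]

theorem isClosed_graph_diagonalizers :
    IsClosed {z : Matrix (Fin r) (Fin r) ℝ × Matrix (Fin r) (Fin r) ℝ |
      z.2 ∈ diagonalizers z.1} := by
  have h : {z : Matrix (Fin r) (Fin r) ℝ × Matrix (Fin r) (Fin r) ℝ | z.2 ∈ diagonalizers z.1} =
      {z | z.2 * z.2ᵀ = 1} ∩ ⋂ i, ⋂ j, {z | i ≠ j → (z.2ᵀ * symmPart z.1 * z.2) i j = 0} := by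
    ext z; simp [diagonalizers]
  rw [h]
  refine (isClosed_eq (by fun_prop) continuous_const).inter
    (isClosed_iInter fun i => isClosed_iInter fun j => ?_)
  by_cases hij : i = j
  · simp [hij]
  · simp only [ne_eq, hij, not_false_eq_true, forall_const]
    refine isClosed_eq ?_ continuous_const
    have : Continuous fun z : Matrix (Fin r) (Fin r) ℝ × Matrix (Fin r) (Fin r) ℝ =>
        z.2ᵀ * symmPart z.1 * z.2 := by unfold symmPart; fun_prop
    exact this.matrix_elem i j

/-- The squared Frobenius distance to the identity matrix. -/
noncomputable def distOne (W : Matrix (Fin r) (Fin r) ℝ) : ℝ :=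
  ∑ i, ∑ j, (W i j - (1 : Matrix (Fin r) (Fin r) ℝ) i j) ^ 2

theorem continuous_distOne : Continuous (distOne (r := r)) := by
  unfold distOne; fun_prop

theorem isCompact_diagonalizers (B : Matrix (Fin r) (Fin r) ℝ) : IsCompact (diagonalizers B) :=
  isCompact_orthogonal.of_isClosed_subset
    (isClosed_graph_diagonalizers.preimage
      (f := fun W => ((B, W) : Matrix (Fin r) (Fin r) ℝ × Matrix (Fin r) (Fin r) ℝ))
      (by fun_prop)) (fun _ h => h.1)

theorem exists_measurable_eigenvectors (r : ℕ) :
    ∃ w : Matrix (Fin r) (Fin r) ℝ → Matrix (Fin r) (Fin r) ℝ, Measurable w ∧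
      ∀ B, w B ∈ minimizers distOne (diagonalizers B) := by
  have hF : HitsMeasurably (diagonalizers (r := r)) :=
    HitsMeasurably.of_isClosed_graph isCompact_orthogonal (fun _ _ h => h.1)
      isClosed_graph_diagonalizers
  refine hF.exists_measurable_selection
    ((Finset.univ : Finset (Fin r × Fin r)).toList.map fun ij W => W ij.1 ij.2) ?_ ?_
    continuous_distOne isCompact_diagonalizers diagonalizers_nonempty
  · intro f hf
    obtain ⟨ij, -, rfl⟩ := List.mem_map.1 hf
    fun_prop
  · intro v w h
    ext i j
    exact h (fun W => W i j) (List.mem_map.2 ⟨(i, j), by simp, rfl⟩)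

/-- A measurable choice of an orthogonal matrix of eigenvectors of the symmetric part of `B`, as
close to the identity as possible. -/
noncomputable def eigvec (B : Matrix (Fin r) (Fin r) ℝ) : Matrix (Fin r) (Fin r) ℝ :=
  (exists_measurable_eigenvectors r).choose B

theorem measurable_eigvec : Measurable (eigvec (r := r)) :=
  (exists_measurable_eigenvectors r).choose_spec.1

theorem eigvec_mem (B : Matrix (Fin r) (Fin r) ℝ) :
    eigvec B ∈ minimizers distOne (diagonalizers B) :=
  (exists_measurable_eigenvectors r).choose_spec.2 B

theorem eigvec_mul_transpose (B : Matrix (Fin r) (Fin r) ℝ) : eigvec B * (eigvec B)ᵀ = 1 :=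
  (eigvec_mem B).1.1

theorem eigvec_transpose_mul (B : Matrix (Fin r) (Fin r) ℝ) : (eigvec B)ᵀ * eigvec B = 1 :=
  mul_eq_one_comm.1 (eigvec_mul_transpose B)

/-- The eigenvalues that belong to the columns of `eigvec B`. -/
noncomputable def eigval (B : Matrix (Fin r) (Fin r) ℝ) (i : Fin r) : ℝ :=
  ((eigvec B)ᵀ * symmPart B * eigvec B) i i

theorem eigvec_conj (B : Matrix (Fin r) (Fin r) ℝ) :
    (eigvec B)ᵀ * symmPart B * eigvec B = diagonal (eigval B) := by
  ext i j
  by_cases h : i = j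
  · subst h; simp [eigval]
  · rw [diagonal_apply_ne _ h]
    exact (eigvec_mem B).1.2 i j h

theorem eigvec_decomp (B : Matrix (Fin r) (Fin r) ℝ) :
    symmPart B = eigvec B * diagonal (eigval B) * (eigvec B)ᵀ := by
  rw [← eigvec_conj]
  calc symmPart B = (eigvec B * (eigvec B)ᵀ) * symmPart B * (eigvec B * (eigvec B)ᵀ) := by
        rw [eigvec_mul_transpose]; simp
    _ = _ := by simp only [Matrix.mul_assoc]

theorem distOne_eq_zero_iff {W : Matrix (Fin r) (Fin r) ℝ} : distOne W = 0 ↔ W = 1 := by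
  constructor
  · intro h
    ext i j
    have h1 := (Finset.sum_eq_zero_iff_of_nonneg
      (fun i _ => Finset.sum_nonneg fun j _ => sq_nonneg _)).1 h i (Finset.mem_univ i)
    have h2 := (Finset.sum_eq_zero_iff_of_nonneg (fun j _ => sq_nonneg _)).1 h1 j
      (Finset.mem_univ j)
    exact sub_eq_zero.1 (pow_eq_zero_iff (two_ne_zero) |>.1 h2)
  · rintro rfl
    simp [distOne]

/-- A diagonalizer of a diagonal matrix with distinct entries conjugates diagonal matrices to
diagonal matrices. -/
theorem conj_diagonal_offDiag {b : Fin r → ℝ} (hb : Function.Injective b)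
    {W : Matrix (Fin r) (Fin r) ℝ} (hW : W ∈ diagonalizers (diagonal b)) (d : Fin r → ℝ)
    {i j : Fin r} (hij : i ≠ j) : (W * diagonal d * Wᵀ) i j = 0 := by
  obtain ⟨h1, h2⟩ := hW
  rw [symmPart_of_symm (diagonal_transpose b)] at h2
  have h3 : ∃ e : Fin r → ℝ, Wᵀ * diagonal b * W = diagonal e := by
    refine ⟨fun i => (Wᵀ * diagonal b * W) i i, ?_⟩
    ext i j
    by_cases h : i = j
    · subst h; simp
    · rw [diagonal_apply_ne _ h, h2 i j h]
  obtain ⟨e, he⟩ := h3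
  have h4 : diagonal b * W = W * diagonal e := by
    rw [← he]
    calc diagonal b * W = (W * Wᵀ) * diagonal b * W := by rw [h1]; simp
      _ = _ := by simp only [Matrix.mul_assoc]
  have h5 : ∀ i m, b i * W i m = W i m * e m := fun i m => by
    have := congrFun (congrFun h4 i) m
    simpa using this
  rw [Matrix.mul_apply]
  refine Finset.sum_eq_zero fun m _ => ?_
  rw [Matrix.mul_diagonal, Matrix.transpose_apply]
  by_cases hi : W i m = 0
  · simp [hi]
  by_cases hj : W j m = 0
  · simp [hj]
  exfalso
  have e1 : b i = e m := by have := h5 i m; rw [mul_comm] at this; exact mul_left_cancel₀ hi this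
  have e2 : b j = e m := by have := h5 j m; rw [mul_comm] at this; exact mul_left_cancel₀ hj this
  exact hij (hb (e1.trans e2.symm))

/-- The chosen eigenvectors converge to the identity when the matrix converges to a diagonal matrix
with distinct entries. -/
theorem tendsto_eigvec {α : Type*} {l : Filter α} {B : α → Matrix (Fin r) (Fin r) ℝ}
    {b : Fin r → ℝ} (hb : Function.Injective b) (hB : Tendsto B l (𝓝 (diagonal b))) :
    Tendsto (fun x => eigvec (B x)) l (𝓝 1) := by
  rw [tendsto_iff_ultrafilter]
  intro u hu
  have hBu : Tendsto B u (𝓝 (diagonal b)) := hB.mono_left hu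
  have hex : ∀ v : Ultrafilter α, Tendsto B v (𝓝 (diagonal b)) → ∃ W : Matrix (Fin r) (Fin r) ℝ,
      Tendsto (fun x => eigvec (B x)) v (𝓝 W) ∧ W ∈ diagonalizers (diagonal b) := by
    intro v hv
    obtain ⟨W, -, hW⟩ := isCompact_orthogonal.ultrafilter_le_nhds
      (v.map fun x => eigvec (B x))
      (by
        rw [le_principal_iff, Ultrafilter.coe_map, mem_map]
        exact Filter.univ_mem' fun x => eigvec_mul_transpose (B x))
    have hW' : Tendsto (fun x => eigvec (B x)) v (𝓝 W) := hW
    refine ⟨W, hW', ?_⟩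
    exact isClosed_graph_diagonalizers.mem_of_tendsto (hv.prodMk_nhds hW')
      (Eventually.of_forall fun x => (eigvec_mem (B x)).1)
  obtain ⟨W, hW, hWmem⟩ := hex u hBu
  have hWone : W = 1 := by
    rw [← distOne_eq_zero_iff]
    have hlim1 : Tendsto (fun x => distOne (eigvec (B x))) u (𝓝 (distOne W)) :=
      (continuous_distOne.tendsto W).comp hW
    have hlim2 : Tendsto (fun x => distOne (eigvec (B x) * Wᵀ)) u (𝓝 (distOne (W * Wᵀ))) := by
      have hc : Continuous fun V : Matrix (Fin r) (Fin r) ℝ => distOne (V * Wᵀ) :=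
        continuous_distOne.comp (by fun_prop)
      exact (hc.tendsto W).comp hW
    rw [hWmem.1, distOne_eq_zero_iff.2 rfl] at hlim2
    have hle : distOne W ≤ 0 := by
      refine le_of_tendsto_of_tendsto' hlim1 hlim2 fun x => (eigvec_mem (B x)).2 _ ?_
      refine ⟨?_, fun i j hij => ?_⟩
      · have hW2 : Wᵀ * W = 1 := mul_eq_one_comm.1 hWmem.1
        calc eigvec (B x) * Wᵀ * (eigvec (B x) * Wᵀ)ᵀ
            = eigvec (B x) * (Wᵀ * W) * (eigvec (B x))ᵀ := by
              simp only [Matrix.transpose_mul, Matrix.transpose_transpose, Matrix.mul_assoc]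
          _ = 1 := by rw [hW2, Matrix.mul_one, eigvec_mul_transpose]
      · have : (eigvec (B x) * Wᵀ)ᵀ * symmPart (B x) * (eigvec (B x) * Wᵀ) =
            W * diagonal (eigval (B x)) * Wᵀ := by
          rw [← eigvec_conj]
          simp only [Matrix.transpose_mul, Matrix.transpose_transpose, Matrix.mul_assoc]
        rw [this]
        exact conj_diagonal_offDiag hb hWmem _ hij
    exact le_antisymm hle (Finset.sum_nonneg fun i _ => Finset.sum_nonneg fun j _ => sq_nonneg _)
  rw [← hWone]
  exact hW

end Eigen

open Asymptotics

/-! ### First-order expansions along a filter -/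

section Expansion

variable {α : Type*} {l : Filter α} {e : α → ℝ}

/-- `f = c + d + O(e ^ 2)`, where `c` is constant and `d = O(e)`. -/
structure HasExpansion (l : Filter α) (e : α → ℝ) (f : α → ℝ) (c : ℝ) (d : α → ℝ) : Prop where
  linear : d =O[l] e
  remainder : (fun x => f x - c - d x) =O[l] fun x => e x ^ 2

theorem IsBigO.mul_sq {f g : α → ℝ} (hf : f =O[l] e) (hg : g =O[l] e) :
    (fun x => f x * g x) =O[l] fun x => e x ^ 2 := by
  simpa only [sq] using IsBigO.mul hf hg

theorem isBigO_sum {ι : Type*} {s : Finset ι} {f : ι → α → ℝ} {g : α → ℝ}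
    (h : ∀ i ∈ s, f i =O[l] g) : (fun x => ∑ i ∈ s, f i x) =O[l] g := by
  have := IsBigO.sum h
  rwa [Finset.sum_fn] at this

theorem sq_isBigO_self (he : Tendsto e l (𝓝 0)) : (fun x => e x ^ 2) =O[l] e := by
  have h : e =O[l] fun _ => (1 : ℝ) := he.isBigO_one ℝ
  simpa [sq] using h.mul (isBigO_refl e l)

namespace HasExpansion

variable {f g d d' : α → ℝ} {c c' : ℝ}

theorem congr (h : HasExpansion l e f c d) (hc : c = c') (hd : d = d') :
    HasExpansion l e f c' d' := hc ▸ hd ▸ h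

theorem congr_left (h : HasExpansion l e f c d) (hfg : f =ᶠ[l] g) : HasExpansion l e g c d :=
  ⟨h.linear, h.remainder.congr' (hfg.mono fun x hx => by simp [hx]) EventuallyEq.rfl⟩

theorem of_isBigO (h : (fun x => f x - c) =O[l] e) :
    HasExpansion l e f c fun x => f x - c :=
  ⟨h, by simpa using isBigO_zero _ _⟩

theorem of_isBigO_sq (h : (fun x => f x - c) =O[l] fun x => e x ^ 2) :
    HasExpansion l e f c 0 :=
  ⟨isBigO_zero _ _, by simpa using h⟩

theorem sub_const (he : Tendsto e l (𝓝 0)) (h : HasExpansion l e f c d) :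
    (fun x => f x - c) =O[l] e := by
  have := (h.remainder.trans (sq_isBigO_self he)).add h.linear
  simpa using this

theorem tendsto (he : Tendsto e l (𝓝 0)) (h : HasExpansion l e f c d) : Tendsto f l (𝓝 c) := by
  have h1 := (h.sub_const he).trans_tendsto he
  simpa using h1.add_const c

theorem isBigO_one (he : Tendsto e l (𝓝 0)) (h : HasExpansion l e f c d) :
    f =O[l] fun _ => (1 : ℝ) :=
  (h.tendsto he).isBigO_one ℝ

theorem linear_congr (h : HasExpansion l e f c d)
    (hd : (fun x => d x - d' x) =O[l] fun x => e x ^ 2) (hd' : d' =O[l] e) :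
    HasExpansion l e f c d' := by
  refine ⟨hd', ?_⟩
  have := h.remainder.add hd
  refine this.congr_left fun x => by ring

theorem const_mul (a : ℝ) (hf : HasExpansion l e f c d) :
    HasExpansion l e (fun x => a * f x) (a * c) (fun x => a * d x) :=
  ⟨hf.linear.const_mul_left a, (hf.remainder.const_mul_left a).congr_left fun x => by ring⟩

theorem sum {ι : Type*} (s : Finset ι) {f : ι → α → ℝ} {c : ι → ℝ} {d : ι → α → ℝ}
    (h : ∀ i ∈ s, HasExpansion l e (f i) (c i) (d i)) :
    HasExpansion l e (fun x => ∑ i ∈ s, f i x) (∑ i ∈ s, c i) (fun x => ∑ i ∈ s, d i x) := by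
  refine ⟨isBigO_sum fun i hi => (h i hi).linear, ?_⟩
  refine (isBigO_sum fun i hi => (h i hi).remainder).congr_left fun x => ?_
  simp [Finset.sum_sub_distrib]

theorem mul (he : Tendsto e l (𝓝 0)) (hf : HasExpansion l e f c d)
    (hg : HasExpansion l e g c' d') :
    HasExpansion l e (fun x => f x * g x) (c * c') (fun x => c * d' x + c' * d x) := by
  refine ⟨(hg.linear.const_mul_left c).add (hf.linear.const_mul_left c'), ?_⟩
  have h1 := IsBigO.mul_sq (hf.sub_const he) (hg.sub_const he)
  have h2 := hf.remainder.const_mul_left c'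
  have h3 := hg.remainder.const_mul_left c
  refine ((h1.add h2).add h3).congr_left fun x => by ring

end HasExpansion

end Expansion

/-! ### The inverse square root of a symmetric matrix near the identity -/

section InvSqrt

variable {r : ℕ}

/-- The matrix `U D^(-1/2) Uᵀ` for the symmetric matrix `S = U D Uᵀ`. -/
noncomputable def invSqrt (S : Matrix (Fin r) (Fin r) ℝ) : Matrix (Fin r) (Fin r) ℝ :=
  eigvec S * diagonal (fun i => (√(eigval S i))⁻¹) * (eigvec S)ᵀ

theorem mul_diagonal_mul_transpose_apply (U : Matrix (Fin r) (Fin r) ℝ) (d : Fin r → ℝ)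
    (i j : Fin r) : (U * diagonal d * Uᵀ) i j = ∑ k, U i k * d k * U j k := by
  rw [Matrix.mul_apply]
  exact Finset.sum_congr rfl fun k _ => by rw [Matrix.mul_diagonal, Matrix.transpose_apply]

theorem mulVec_injective_of_mul_eq_one {U V : Matrix (Fin r) (Fin r) ℝ} (h : U * V = 1) :
    Function.Injective fun v => v ᵥ* U := by
  intro v w hvw
  have := congrArg (fun u => u ᵥ* V) hvw
  simpa [Matrix.vecMul_vecMul, h] using this

theorem posDef_conj_diagonal (B : Matrix (Fin r) (Fin r) ℝ) {d : Fin r → ℝ} (hd : ∀ i, 0 < d i) :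
    (eigvec B * diagonal d * (eigvec B)ᵀ).PosDef := by
  have h := (PosDef.diagonal hd).mul_mul_conjTranspose_same (B := eigvec B)
    (mulVec_injective_of_mul_eq_one (eigvec_mul_transpose B))
  simpa only [Matrix.conjTranspose_eq_transpose_of_trivial] using h

theorem transpose_eq_of_posDef {S : Matrix (Fin r) (Fin r) ℝ} (hS : S.PosDef) : Sᵀ = S := by
  have := hS.1
  rwa [Matrix.IsHermitian, Matrix.conjTranspose_eq_transpose_of_trivial] at this

theorem eigval_pos {S : Matrix (Fin r) (Fin r) ℝ} (hS : S.PosDef) (i : Fin r) :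
    0 < eigval S i := by
  have h := hS.mul_mul_conjTranspose_same (B := (eigvec S)ᵀ)
    (mulVec_injective_of_mul_eq_one (eigvec_transpose_mul S))
  rw [Matrix.conjTranspose_eq_transpose_of_trivial, Matrix.transpose_transpose] at h
  have h2 := eigvec_conj S
  rw [symmPart_of_symm (transpose_eq_of_posDef hS)] at h2
  rw [h2, posDef_diagonal_iff] at h
  exact h i

theorem isSymmInvSqrt_invSqrt {S : Matrix (Fin r) (Fin r) ℝ} (hS : S.PosDef) :
    IsSymmInvSqrt (invSqrt S) S := by
  have hpos := eigval_pos hS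
  refine ⟨posDef_conj_diagonal S fun i => inv_pos.2 (Real.sqrt_pos.2 (hpos i)), ?_⟩
  have h2 := eigvec_conj S
  rw [symmPart_of_symm (transpose_eq_of_posDef hS)] at h2
  have h3 : (invSqrt S)ᵀ = invSqrt S := by
    simp [invSqrt, Matrix.transpose_mul, Matrix.mul_assoc]
  rw [h3]
  set U := eigvec S with hU
  set D := diagonal (fun i => (√(eigval S i))⁻¹) with hD
  calc U * D * Uᵀ * S * (U * D * Uᵀ) = U * D * (Uᵀ * S * U) * D * Uᵀ := by
        simp only [Matrix.mul_assoc]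
    _ = U * (D * diagonal (eigval S) * D) * Uᵀ := by rw [h2]; simp only [Matrix.mul_assoc]
    _ = U * 1 * Uᵀ := by
        congr 2
        rw [hD, diagonal_mul_diagonal, diagonal_mul_diagonal, ← diagonal_one]
        congr 1
        funext i
        have h4 := Real.sqrt_pos.2 (hpos i)
        have h5 := Real.mul_self_sqrt (hpos i).le
        field_simp
        nlinarith
    _ = 1 := by rw [Matrix.mul_one, hU, eigvec_mul_transpose]

theorem measurable_matrix {X : Type*} [MeasurableSpace X] {m n : Type*}
    {f : X → Matrix m n ℝ} (h : ∀ i j, Measurable fun x => f x i j) : Measurable f :=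
  measurable_pi_iff.2 fun i => measurable_pi_iff.2 fun j => h i j

theorem measurable_entry {X : Type*} [MeasurableSpace X] {m n : Type*}
    {f : X → Matrix m n ℝ} (h : Measurable f) (i : m) (j : n) : Measurable fun x => f x i j :=
  measurable_pi_iff.1 (measurable_pi_iff.1 h i) j

theorem measurable_matrix_mul {X : Type*} [MeasurableSpace X] {m n k : Type*} [Fintype n]
    {f : X → Matrix m n ℝ} {g : X → Matrix n k ℝ} (hf : Measurable f) (hg : Measurable g) :
    Measurable fun x => f x * g x := by
  refine measurable_matrix fun i j => ?_
  simp only [Matrix.mul_apply]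
  exact Finset.measurable_sum _ fun a _ => (measurable_entry hf i a).mul (measurable_entry hg a j)

theorem measurable_matrix_transpose {X : Type*} [MeasurableSpace X] {m n : Type*}
    {f : X → Matrix m n ℝ} (hf : Measurable f) : Measurable fun x => (f x)ᵀ :=
  measurable_matrix fun i j => measurable_entry hf j i

theorem measurable_symmPart : Measurable (symmPart (r := r)) :=
  measurable_matrix fun i j =>
    ((measurable_entry measurable_id i j).add (measurable_entry measurable_id j i)).const_mul _

theorem measurable_eigval (i : Fin r) : Measurable fun S : Matrix (Fin r) (Fin r) ℝ => eigval S i :=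
  measurable_entry (measurable_matrix_mul (measurable_matrix_mul
    (measurable_matrix_transpose measurable_eigvec) measurable_symmPart) measurable_eigvec) i i

theorem measurable_invSqrt : Measurable (invSqrt (r := r)) := by
  refine measurable_matrix_mul (measurable_matrix_mul measurable_eigvec ?_)
    (measurable_matrix_transpose measurable_eigvec)
  refine measurable_matrix fun i j => ?_
  by_cases h : i = j
  · subst h
    simp only [diagonal_apply_eq]
    exact (measurable_eigval i).sqrt.inv
  · simp [diagonal_apply_ne _ h]

theorem inv_sqrt_expansion :
    (fun d : ℝ => (√d)⁻¹ - 1 + 1 / 2 * (d - 1)) =O[𝓝 1] fun d => (d - 1) ^ 2 := by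
  refine IsBigO.of_bound 3 ?_
  filter_upwards [lt_mem_nhds (show (1 / 4 : ℝ) < 1 by norm_num)] with d hd
  have hd0 : 0 ≤ d := by linarith
  have hs : 1 / 2 < √d := by
    rw [Real.lt_sqrt (by norm_num)]; norm_num; linarith
  obtain ⟨s, hsd⟩ : ∃ s, s = √d := ⟨_, rfl⟩
  have hsq : d = s ^ 2 := by rw [hsd, Real.sq_sqrt hd0]
  rw [← hsd] at hs ⊢
  have hs0 : 0 < s := by linarith
  have h1 : s⁻¹ - 1 + 1 / 2 * (d - 1) = (s - 1) ^ 2 * (1 / 2 + s⁻¹) := by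
    rw [hsq]; field_simp; ring
  have h2 : s⁻¹ ≤ 2 := by
    rw [inv_le_comm₀ hs0 (by norm_num)]; linarith
  have h3 : 0 < s⁻¹ := inv_pos.2 hs0
  have h4 : (d - 1) ^ 2 = (s - 1) ^ 2 * (s + 1) ^ 2 := by rw [hsq]; ring
  rw [Real.norm_eq_abs, Real.norm_eq_abs, abs_of_nonneg (sq_nonneg (d - 1)), h1,
    abs_of_nonneg (by positivity), h4]
  have h5 : (s - 1) ^ 2 * (1 / 2 + s⁻¹) ≤ (s - 1) ^ 2 * 3 := by
    apply mul_le_mul_of_nonneg_left _ (sq_nonneg _); linarith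
  have h6 : (s - 1) ^ 2 * 1 ≤ (s - 1) ^ 2 * (s + 1) ^ 2 := by
    apply mul_le_mul_of_nonneg_left _ (sq_nonneg _); nlinarith
  linarith

variable {α : Type*} {l : Filter α} {e : α → ℝ}

theorem isBigO_eigvec (S : α → Matrix (Fin r) (Fin r) ℝ) (i j : Fin r) :
    (fun x => eigvec (S x) i j) =O[l] fun _ => (1 : ℝ) :=
  IsBigO.of_bound 1 (Eventually.of_forall fun x => by
    simpa using abs_le_one_of_mul_transpose (eigvec_mul_transpose (S x)) i j)

theorem eigval_sub_one_isBigO {S : α → Matrix (Fin r) (Fin r) ℝ} (hsymm : ∀ x, (S x)ᵀ = S x)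
    (hS : ∀ i j, (fun x => S x i j - (1 : Matrix (Fin r) (Fin r) ℝ) i j) =O[l] e) (i : Fin r) :
    (fun x => eigval (S x) i - 1) =O[l] e := by
  have h : ∀ x, eigval (S x) i - 1 = ∑ k, ∑ j, eigvec (S x) j i *
      (S x j k - (1 : Matrix (Fin r) (Fin r) ℝ) j k) * eigvec (S x) k i := by
    intro x
    have h1 : eigval (S x) i - 1 = ((eigvec (S x))ᵀ * (S x - 1) * eigvec (S x)) i i := by
      rw [Matrix.mul_sub, Matrix.sub_mul, Matrix.mul_one, eigvec_transpose_mul, eigval,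
        symmPart_of_symm (hsymm x)]
      simp
    rw [h1]
    simp only [Matrix.mul_apply, Matrix.sub_apply, Matrix.transpose_apply, Finset.sum_mul]
  simp only [h]
  refine isBigO_sum fun k _ => isBigO_sum fun j _ => ?_
  simpa using ((isBigO_eigvec S j i).mul (hS j k)).mul (isBigO_eigvec S k i)

theorem eventually_posDef {S : α → Matrix (Fin r) (Fin r) ℝ} (he : Tendsto e l (𝓝 0))
    (hsymm : ∀ x, (S x)ᵀ = S x)
    (hS : ∀ i j, (fun x => S x i j - (1 : Matrix (Fin r) (Fin r) ℝ) i j) =O[l] e) :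
    ∀ᶠ x in l, (S x).PosDef := by
  have h1 : ∀ᶠ x in l, ∀ i, 0 < eigval (S x) i := by
    refine eventually_all.2 fun i => ?_
    have h := ((eigval_sub_one_isBigO hsymm hS i).trans_tendsto he).add_const 1
    simp only [sub_add_cancel, zero_add] at h
    exact h.eventually (lt_mem_nhds zero_lt_one)
  filter_upwards [h1] with x hx
  have := posDef_conj_diagonal (S x) hx
  rwa [← eigvec_decomp, symmPart_of_symm (hsymm x)] at this

theorem invSqrt_expansion {S : α → Matrix (Fin r) (Fin r) ℝ} (he : Tendsto e l (𝓝 0))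
    (hsymm : ∀ x, (S x)ᵀ = S x)
    (hS : ∀ i j, (fun x => S x i j - (1 : Matrix (Fin r) (Fin r) ℝ) i j) =O[l] e) (i j : Fin r) :
    HasExpansion l e (fun x => invSqrt (S x) i j) ((1 : Matrix (Fin r) (Fin r) ℝ) i j)
      (fun x => -(1 / 2) * (S x i j - (1 : Matrix (Fin r) (Fin r) ℝ) i j)) := by
  refine ⟨(hS i j).const_mul_left _, ?_⟩
  have h : ∀ x, invSqrt (S x) i j - (1 : Matrix (Fin r) (Fin r) ℝ) i j -
      -(1 / 2) * (S x i j - (1 : Matrix (Fin r) (Fin r) ℝ) i j) =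
      ∑ k, eigvec (S x) i k *
        ((√(eigval (S x) k))⁻¹ - 1 + 1 / 2 * (eigval (S x) k - 1)) * eigvec (S x) j k := by
    intro x
    have h1 : S x i j = ∑ k, eigvec (S x) i k * eigval (S x) k * eigvec (S x) j k := by
      conv_lhs => rw [← symmPart_of_symm (hsymm x), eigvec_decomp]
      exact mul_diagonal_mul_transpose_apply _ _ _ _
    have h2 : (1 : Matrix (Fin r) (Fin r) ℝ) i j = ∑ k, eigvec (S x) i k * eigvec (S x) j k := by
      conv_lhs => rw [← eigvec_mul_transpose (S x)]
      simp [Matrix.mul_apply]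
    have h3 : invSqrt (S x) i j =
        ∑ k, eigvec (S x) i k * (√(eigval (S x) k))⁻¹ * eigvec (S x) j k := by
      exact mul_diagonal_mul_transpose_apply _ _ _ _
    rw [h1, h2, h3, ← Finset.sum_sub_distrib, ← Finset.sum_sub_distrib, Finset.mul_sum,
      ← Finset.sum_sub_distrib]
    exact Finset.sum_congr rfl fun k _ => by ring
  simp only [h]
  refine isBigO_sum fun k _ => ?_
  have h4 := eigval_sub_one_isBigO hsymm hS k
  have h5 : Tendsto (fun x => eigval (S x) k) l (𝓝 1) := by
    have := (h4.trans_tendsto he).add_const 1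
    simpa using this
  have h6 : (fun x => (√(eigval (S x) k))⁻¹ - 1 + 1 / 2 * (eigval (S x) k - 1)) =O[l]
      fun x => e x ^ 2 :=
    (inv_sqrt_expansion.comp_tendsto h5).trans (h4.pow 2)
  simpa using ((isBigO_eigvec S i k).mul h6).mul (isBigO_eigvec S j k)

end InvSqrt

/-! ### First-order perturbation of eigenvectors -/

section Perturbation

variable {r : ℕ} {α : Type*} {l : Filter α} {e : α → ℝ}

theorem eigvec_expansion {B : α → Matrix (Fin r) (Fin r) ℝ} {b : Fin r → ℝ}
    (he : Tendsto e l (𝓝 0)) (hb : Function.Injective b) (hsymm : ∀ x, (B x)ᵀ = B x)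
    (hB : ∀ i j, (fun x => B x i j - diagonal b i j) =O[l] e) (i j : Fin r) :
    HasExpansion l e (fun x => eigvec (B x) i j) ((1 : Matrix (Fin r) (Fin r) ℝ) i j)
      (fun x => if i = j then 0 else B x i j / (b j - b i)) := by
  have hBlim : Tendsto B l (𝓝 (diagonal b)) := by
    refine tendsto_pi_nhds.2 fun i => tendsto_pi_nhds.2 fun j => ?_
    have := ((hB i j).trans_tendsto he).add_const (diagonal b i j)
    simpa using this
  have hW := tendsto_eigvec hb hBlim
  have hWij : ∀ i j, Tendsto (fun x => eigvec (B x) i j) l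
      (𝓝 ((1 : Matrix (Fin r) (Fin r) ℝ) i j)) :=
    fun i j => tendsto_pi_nhds.1 (tendsto_pi_nhds.1 hW i) j
  have hlam : ∀ j, Tendsto (fun x => eigval (B x) j) l (𝓝 (b j)) := by
    intro j
    have hc : Continuous fun z : Matrix (Fin r) (Fin r) ℝ × Matrix (Fin r) (Fin r) ℝ =>
        (z.2ᵀ * z.1 * z.2) j j := by fun_prop
    have := (hc.tendsto (diagonal b, 1)).comp (hBlim.prodMk_nhds hW)
    simp only [Matrix.transpose_one, Matrix.one_mul, Matrix.mul_one, diagonal_apply_eq] at this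
    refine this.congr fun x => ?_
    simp [eigval, symmPart_of_symm (hsymm x)]
  have heq : ∀ x i j, ∑ m, B x i m * eigvec (B x) m j = eigvec (B x) i j * eigval (B x) j := by
    intro x i j
    have h1 : B x * eigvec (B x) = eigvec (B x) * diagonal (eigval (B x)) := by
      conv_lhs => rw [← symmPart_of_symm (hsymm x)]
      conv_lhs => enter [1]; rw [eigvec_decomp]
      rw [symmPart_of_symm (hsymm x), Matrix.mul_assoc, eigvec_transpose_mul, Matrix.mul_one]
    have := congrFun (congrFun h1 i) j
    rw [Matrix.mul_diagonal] at this
    rw [← this, Matrix.mul_apply]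
  have hoff : ∀ i j, i ≠ j → (fun x => B x i j) =O[l] e := by
    intro i j hij
    simpa [diagonal_apply_ne _ hij] using hB i j
  have hne : ∀ i j, i ≠ j → b j - b i ≠ 0 := fun i j hij h => hij (hb (sub_eq_zero.1 h).symm)
  have hsplit : ∀ x i j, i ≠ j → eigvec (B x) i j * (eigval (B x) j - B x i i) =
      ∑ m ∈ Finset.univ.erase i, B x i m * eigvec (B x) m j := by
    intro x i j hij
    have h1 := heq x i j
    rw [← Finset.add_sum_erase _ _ (Finset.mem_univ i)] at h1
    linarith
  have hgap : ∀ i j, Tendsto (fun x => eigval (B x) j - B x i i) l (𝓝 (b j - b i)) := by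
    intro i j
    have h1 : Tendsto (fun x => B x i i) l (𝓝 (b i)) := by
      have := tendsto_pi_nhds.1 (tendsto_pi_nhds.1 hBlim i) i
      simpa using this
    exact (hlam j).sub h1
  have hWoff : ∀ i j, i ≠ j → (fun x => eigvec (B x) i j) =O[l] e := by
    intro i j hij
    have h1 : (fun x => eigvec (B x) i j * (eigval (B x) j - B x i i)) =O[l] e := by
      simp only [fun x => hsplit x i j hij]
      refine isBigO_sum fun m hm => ?_
      simpa using (hoff i m (Finset.ne_of_mem_erase hm).symm).mul (isBigO_eigvec B m j)
    have h2 := ((hgap i j).inv₀ (hne i j hij)).isBigO_one ℝ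
    have h3 := h1.mul h2
    simp only [mul_one] at h3
    refine h3.congr' ?_ EventuallyEq.rfl
    filter_upwards [(hgap i j).eventually_ne (hne i j hij)] with x hx
    rw [mul_assoc, mul_inv_cancel₀ hx, mul_one]
  have hdiag : ∀ i, (fun x => eigvec (B x) i i - 1) =O[l] fun x => e x ^ 2 := by
    intro i
    have h1 : ∀ x, eigvec (B x) i i ^ 2 - 1 =
        - ∑ m ∈ Finset.univ.erase i, eigvec (B x) i m * eigvec (B x) i m := by
      intro x
      have h2 := congrFun (congrFun (eigvec_mul_transpose (B x)) i) i
      rw [Matrix.mul_apply, ← Finset.add_sum_erase _ _ (Finset.mem_univ i)] at h2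
      simp only [Matrix.transpose_apply, Matrix.one_apply_eq] at h2
      linarith
    have h3 : (fun x => eigvec (B x) i i ^ 2 - 1) =O[l] fun x => e x ^ 2 := by
      simp only [h1]
      refine (isBigO_sum fun m hm => ?_).neg_left
      have := hWoff i m (Finset.ne_of_mem_erase hm).symm
      exact IsBigO.mul_sq this this
    have h4 : Tendsto (fun x => eigvec (B x) i i + 1) l (𝓝 2) := by
      have := (hWij i i).add_const 1
      rw [Matrix.one_apply_eq] at this
      norm_num at this
      exact this
    have h5 := h3.mul ((h4.inv₀ two_ne_zero).isBigO_one ℝ)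
    simp only [mul_one] at h5
    refine h5.congr' ?_ EventuallyEq.rfl
    filter_upwards [(hWij i i).eventually (lt_mem_nhds (show (0 : ℝ) < (1 : Matrix (Fin r) (Fin r) ℝ) i i by
      simp))] with x hx
    have : eigvec (B x) i i + 1 ≠ 0 := by linarith
    field_simp
    ring
  by_cases hij : i = j
  · subst hij
    simp only [if_true, Matrix.one_apply_eq]
    exact HasExpansion.of_isBigO_sq (hdiag i)
  · simp only [if_neg hij, Matrix.one_apply_ne hij]
    have hlamO : (fun x => eigval (B x) j - B x i i - (b j - b i)) =O[l] e := by
      have h1 : ∀ x, eigval (B x) j - B x j j =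
          ∑ m ∈ Finset.univ.erase j, (B x j m * eigvec (B x) m j) +
            (1 - eigvec (B x) j j) * (eigval (B x) j - B x j j) := by
        intro x
        have h2 := heq x j j
        rw [← Finset.add_sum_erase _ _ (Finset.mem_univ j)] at h2
        linarith
      have h3 : Tendsto (fun x => eigvec (B x) j j) l (𝓝 1) := by simpa using hWij j j
      have h4 : (fun x => eigvec (B x) j j * (eigval (B x) j - B x j j)) =O[l] e := by
        have : ∀ x, eigvec (B x) j j * (eigval (B x) j - B x j j) =
            ∑ m ∈ Finset.univ.erase j, (B x j m * eigvec (B x) m j) := fun x => by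
          linarith [h1 x]
        simp only [this]
        refine isBigO_sum fun m hm => ?_
        simpa using (hoff j m (Finset.ne_of_mem_erase hm).symm).mul (isBigO_eigvec B m j)
      have h5 : (fun x => eigval (B x) j - B x j j) =O[l] e := by
        have h6 := h4.mul ((h3.inv₀ one_ne_zero).isBigO_one ℝ)
        simp only [mul_one] at h6
        refine h6.congr' ?_ EventuallyEq.rfl
        filter_upwards [h3.eventually_ne one_ne_zero] with x hx
        field_simp
      have h7 := hB j j
      have h8 := hB i i
      simp only [diagonal_apply_eq] at h7 h8
      exact ((h5.add h7).sub h8).congr_left fun x => by ring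
    have hrem : (fun x => (b j - b i)⁻¹ * (∑ m ∈ (Finset.univ.erase i).erase j,
        B x i m * eigvec (B x) m j + B x i j * (eigvec (B x) j j - 1) -
        eigvec (B x) i j * (eigval (B x) j - B x i i - (b j - b i)))) =O[l] fun x => e x ^ 2 := by
      refine IsBigO.const_mul_left ?_ _
      refine ((isBigO_sum fun m hm => ?_).add ?_).sub (IsBigO.mul_sq (hWoff i j hij) hlamO)
      · have hm1 := Finset.ne_of_mem_erase hm
        have hm2 := Finset.ne_of_mem_erase (Finset.mem_of_mem_erase hm)
        exact IsBigO.mul_sq (hoff i m hm2.symm) (hWoff m j hm1)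
      · refine IsBigO.mul_sq (hoff i j hij) ?_
        exact (hdiag j).trans (sq_isBigO_self he)
    refine ⟨by
      simpa only [div_eq_mul_inv, mul_comm] using (hoff i j hij).const_mul_left (b j - b i)⁻¹, ?_⟩
    refine hrem.congr_left fun x => ?_
    have h1 := hsplit x i j hij
    rw [← Finset.add_sum_erase _ _ (Finset.mem_erase.2 ⟨Ne.symm hij, Finset.mem_univ j⟩)] at h1
    have h2 := hne i j hij
    field_simp
    linarith

end Perturbation

/-! ### Empirical moments of order at most four -/

section Moments

variable {n p q : ℕ}

/-- The entries of a matrix, extended by the constant one. -/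
def entryOrOne (z : Matrix (Fin p) (Fin q) ℝ) : Option (Fin p × Fin q) → ℝ
  | none => 1
  | some a => z a.1 a.2

/-- The empirical mean of a product of four (extended) entries. -/
noncomputable def empMoment (x : Fin n → Matrix (Fin p) (Fin q) ℝ)
    (a b c d : Option (Fin p × Fin q)) : ℝ :=
  (1 / (n : ℝ)) * ∑ i, entryOrOne (x i) a * entryOrOne (x i) b * entryOrOne (x i) c *
    entryOrOne (x i) d

/-- The empirical mean of a product of four entries, each centred by the corresponding entry
of `u`. -/
noncomputable def empCentralMoment (u : Matrix (Fin p) (Fin q) ℝ)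
    (x : Fin n → Matrix (Fin p) (Fin q) ℝ) (a b c d : Fin p × Fin q) : ℝ :=
  (1 / (n : ℝ)) * ∑ i, (x i a.1 a.2 - u a.1 a.2) * (x i b.1 b.2 - u b.1 b.2) *
    (x i c.1 c.2 - u c.1 c.2) * (x i d.1 d.2 - u d.1 d.2)

theorem empCentralMoment_eq (u : Matrix (Fin p) (Fin q) ℝ)
    (x : Fin n → Matrix (Fin p) (Fin q) ℝ) (a b c d : Fin p × Fin q) :
    empCentralMoment u x a b c d = empMoment x (some a) (some b) (some c) (some d)
      - u a.1 a.2 * empMoment x none (some b) (some c) (some d)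
      - u b.1 b.2 * empMoment x none (some a) (some c) (some d)
      - u c.1 c.2 * empMoment x none (some a) (some b) (some d)
      - u d.1 d.2 * empMoment x none (some a) (some b) (some c)
      + u a.1 a.2 * u b.1 b.2 * empMoment x none none (some c) (some d)
      + u a.1 a.2 * u c.1 c.2 * empMoment x none none (some b) (some d)
      + u a.1 a.2 * u d.1 d.2 * empMoment x none none (some b) (some c)
      + u b.1 b.2 * u c.1 c.2 * empMoment x none none (some a) (some d)
      + u b.1 b.2 * u d.1 d.2 * empMoment x none none (some a) (some c)
      + u c.1 c.2 * u d.1 d.2 * empMoment x none none (some a) (some b)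
      - u a.1 a.2 * u b.1 b.2 * (u c.1 c.2 * empMoment x none none none (some d))
      - u a.1 a.2 * u b.1 b.2 * (u d.1 d.2 * empMoment x none none none (some c))
      - u a.1 a.2 * u c.1 c.2 * (u d.1 d.2 * empMoment x none none none (some b))
      - u b.1 b.2 * u c.1 c.2 * (u d.1 d.2 * empMoment x none none none (some a))
      + u a.1 a.2 * u b.1 b.2 * (u c.1 c.2 * u d.1 d.2 * empMoment x none none none none) := by
  simp only [empCentralMoment, empMoment, Finset.mul_sum, ← Finset.sum_add_distrib,
    ← Finset.sum_sub_distrib, entryOrOne]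
  exact Finset.sum_congr rfl fun i _ => by ring

theorem empCovariance_eq (u : Matrix (Fin p) (Fin q) ℝ)
    (x : Fin n → Matrix (Fin p) (Fin q) ℝ) (a b : Fin p × Fin q) :
    (1 / (n : ℝ)) * ∑ i, (x i a.1 a.2 - u a.1 a.2) * (x i b.1 b.2 - u b.1 b.2) =
      empMoment x none none (some a) (some b)
      - u a.1 a.2 * empMoment x none none none (some b)
      - u b.1 b.2 * empMoment x none none none (some a)
      + u a.1 a.2 * u b.1 b.2 * empMoment x none none none none := by
  simp only [empMoment, Finset.mul_sum, ← Finset.sum_add_distrib,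
    ← Finset.sum_sub_distrib, entryOrOne]
  exact Finset.sum_congr rfl fun i _ => by ring

theorem sampleMean_apply (x : Fin n → Matrix (Fin p) (Fin q) ℝ) (a : Fin p × Fin q) :
    sampleMean x a.1 a.2 = empMoment x none none none (some a) := by
  simp [sampleMean, empMoment, entryOrOne, Matrix.sum_apply]

theorem sBar_eq (x : Fin n → Matrix (Fin p) (Fin q) ℝ) (k k' : Fin p) :
    sBar x k k' = (1 / (q : ℝ)) * ∑ l, empMoment x none none (some (k, l)) (some (k', l)) := by
  simp [sBar, empMoment, entryOrOne]

theorem leftCov_apply (c : Bool) (x : Fin n → Matrix (Fin p) (Fin q) ℝ) (k k' : Fin p) :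
    leftCov c x k k' = (1 / (q : ℝ)) * ∑ l, (1 / (n : ℝ)) * ∑ i,
      (x i k l - location c x k l) * (x i k' l - location c x k' l) := by
  simp only [leftCov, Matrix.smul_apply, Matrix.sum_apply, smul_eq_mul, Matrix.mul_apply,
    Matrix.transpose_apply, Matrix.sub_apply]
  rw [Finset.sum_comm, Finset.mul_sum (s := Finset.univ) (a := 1 / (n : ℝ))]

theorem rightCov_apply (c : Bool) (x : Fin n → Matrix (Fin p) (Fin q) ℝ) (l l' : Fin q) :
    rightCov c x l l' = (1 / (p : ℝ)) * ∑ k, (1 / (n : ℝ)) * ∑ i,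
      (x i k l - location c x k l) * (x i k l' - location c x k l') := by
  simp only [rightCov, Matrix.smul_apply, Matrix.sum_apply, smul_eq_mul, Matrix.mul_apply,
    Matrix.transpose_apply, Matrix.sub_apply]
  rw [Finset.sum_comm, Finset.mul_sum (s := Finset.univ) (a := 1 / (n : ℝ))]

theorem leftCov_transpose (c : Bool) (x : Fin n → Matrix (Fin p) (Fin q) ℝ) :
    (leftCov c x)ᵀ = leftCov c x := by
  ext k k'
  simp only [Matrix.transpose_apply, leftCov_apply, mul_comm]

theorem rightCov_transpose (c : Bool) (x : Fin n → Matrix (Fin p) (Fin q) ℝ) :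
    (rightCov c x)ᵀ = rightCov c x := by
  ext k k'
  simp only [Matrix.transpose_apply, rightCov_apply, mul_comm]

theorem fobiKernel_transpose (N : Fin 2) (Y : Matrix (Fin p) (Fin q) ℝ) :
    (fobiKernel N Y)ᵀ = fobiKernel N Y := by
  unfold fobiKernel
  split_ifs
  · simp only [Matrix.transpose_mul, Matrix.transpose_transpose, Matrix.mul_assoc]
  · simp only [Matrix.transpose_smul, Matrix.transpose_mul, Matrix.transpose_transpose]

theorem leftFobi_transpose (N : Fin 2) (L : Matrix (Fin p) (Fin p) ℝ)
    (R : Matrix (Fin q) (Fin q) ℝ) (x : Fin n → Matrix (Fin p) (Fin q) ℝ) :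
    (leftFobi N L R x)ᵀ = leftFobi N L R x := by
  simp only [leftFobi, Matrix.transpose_smul, Matrix.transpose_sum, fobiKernel_transpose]

/-- The index set of the sums in `leftFobi_apply`. -/
abbrev KernelIndex (p q : ℕ) := Fin q × Fin q × Fin p × Fin p × Fin q × Fin q

/-- The sum over row and column indices that expresses an entry of the FOBI kernel in terms of
products `T` of four entries of the data. -/
def kernelSum (N : Fin 2) (A : Matrix (Fin q) (Fin q) ℝ) (M : Matrix (Fin p) (Fin p) ℝ)
    (T : Fin p × Fin q → Fin p × Fin q → Fin p × Fin q → Fin p × Fin q → ℝ) (a b : Fin p) : ℝ :=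
  ∑ t : KernelIndex p q, A t.2.2.2.2.2 t.2.2.2.2.1 * M t.2.2.2.1 t.2.2.1 * A t.2.1 t.1 *
    T (if N = 0 then a else t.2.2.1, t.2.2.2.2.2) (t.2.2.2.1, t.2.2.2.2.1)
      (if N = 0 then t.2.2.1 else a, t.2.1) (b, t.1)

theorem fobiKernel_apply (N : Fin 2) (L : Matrix (Fin p) (Fin p) ℝ)
    (R : Matrix (Fin q) (Fin q) ℝ) (X : Matrix (Fin p) (Fin q) ℝ) (k k' : Fin p) :
    fobiKernel N (L * X * Rᵀ) k k' = ∑ a, ∑ b, L k a * L k' b *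
      kernelSum N (Rᵀ * R) (Lᵀ * L)
        (fun a b c d => X a.1 a.2 * X b.1 b.2 * X c.1 c.2 * X d.1 d.2) a b := by
  obtain ⟨C, hC, hsum⟩ : ∃ C : Matrix (Fin p) (Fin p) ℝ,
      fobiKernel N (L * X * Rᵀ) = L * C * Lᵀ ∧ ∀ a b, C a b = kernelSum N (Rᵀ * R) (Lᵀ * L)
        (fun a b c d => X a.1 a.2 * X b.1 b.2 * X c.1 c.2 * X d.1 d.2) a b := by
    by_cases hN : N = 0
    · refine ⟨X * (Rᵀ * R) * Xᵀ * (Lᵀ * L) * X * (Rᵀ * R) * Xᵀ, ?_, fun a b => ?_⟩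
      · simp only [fobiKernel, hN, if_true, Matrix.transpose_mul, Matrix.transpose_transpose,
          Matrix.mul_assoc]
      · generalize Rᵀ * R = A
        generalize Lᵀ * L = M
        simp only [kernelSum, hN, if_true, Fintype.sum_prod_type, Matrix.mul_apply,
          Matrix.transpose_apply, Finset.sum_mul]
        refine Finset.sum_congr rfl fun _ _ => Finset.sum_congr rfl fun _ _ =>
          Finset.sum_congr rfl fun _ _ => Finset.sum_congr rfl fun _ _ =>
          Finset.sum_congr rfl fun _ _ => Finset.sum_congr rfl fun _ _ => by ring
    · refine ⟨(X * (Rᵀ * R) * Xᵀ * (Lᵀ * L)).trace • (X * (Rᵀ * R) * Xᵀ), ?_, fun a b => ?_⟩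
      · have h : ∑ k, ∑ l, (L * X * Rᵀ) k l ^ 2 = (X * (Rᵀ * R) * Xᵀ * (Lᵀ * L)).trace := by
          have h1 : ∑ k, ∑ l, (L * X * Rᵀ) k l ^ 2 = ((L * X * Rᵀ) * (L * X * Rᵀ)ᵀ).trace := by
            simp only [Matrix.trace, Matrix.diag, sq]
            exact Finset.sum_congr rfl fun k _ => by
              rw [Matrix.mul_apply (M := L * X * Rᵀ)]; rfl
          rw [h1]
          have h2 : (L * X * Rᵀ) * (L * X * Rᵀ)ᵀ = L * (X * (Rᵀ * R) * Xᵀ * Lᵀ) := by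
            simp only [Matrix.transpose_mul, Matrix.transpose_transpose, Matrix.mul_assoc]
          rw [h2, Matrix.trace_mul_comm]
          simp only [Matrix.mul_assoc]
        rw [fobiKernel, if_neg hN, h]
        simp only [Matrix.transpose_mul, Matrix.transpose_transpose, Matrix.mul_assoc,
          Matrix.mul_smul, Matrix.smul_mul]
      · generalize Rᵀ * R = A
        generalize Lᵀ * L = M
        simp only [kernelSum, hN, if_false, Fintype.sum_prod_type, Matrix.smul_apply, smul_eq_mul,
          Matrix.trace, Matrix.diag, Matrix.mul_apply, Matrix.transpose_apply, Finset.sum_mul,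
          Finset.mul_sum]
        refine Finset.sum_congr rfl fun _ _ => Finset.sum_congr rfl fun _ _ =>
          Finset.sum_congr rfl fun _ _ => Finset.sum_congr rfl fun _ _ =>
          Finset.sum_congr rfl fun _ _ => Finset.sum_congr rfl fun _ _ => by ring
  rw [hC]
  simp only [Matrix.mul_apply, Matrix.transpose_apply, Finset.sum_mul, hsum]
  rw [Finset.sum_comm]
  exact Finset.sum_congr rfl fun a _ => Finset.sum_congr rfl fun b _ => by ring

theorem leftFobi_apply (N : Fin 2) (L : Matrix (Fin p) (Fin p) ℝ)
    (R : Matrix (Fin q) (Fin q) ℝ) (x : Fin n → Matrix (Fin p) (Fin q) ℝ) (k k' : Fin p) :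
    leftFobi N L R x k k' = ∑ a, ∑ b, L k a * L k' b * ((1 / (q : ℝ)) *
      kernelSum N (Rᵀ * R) (Lᵀ * L) (empCentralMoment (sampleMean x) x) a b) := by
  simp only [leftFobi, Matrix.smul_apply, Matrix.sum_apply, smul_eq_mul, fobiKernel_apply]
  rw [Finset.sum_comm, Finset.mul_sum, Finset.mul_sum]
  refine Finset.sum_congr rfl fun a _ => ?_
  rw [Finset.sum_comm, Finset.mul_sum, Finset.mul_sum]
  refine Finset.sum_congr rfl fun b _ => ?_
  rw [← Finset.mul_sum]
  have h : (1 / (n : ℝ)) * ∑ i, kernelSum N (Rᵀ * R) (Lᵀ * L) (fun a b c d =>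
      (x i - sampleMean x) a.1 a.2 * (x i - sampleMean x) b.1 b.2 *
      (x i - sampleMean x) c.1 c.2 * (x i - sampleMean x) d.1 d.2) a b =
      kernelSum N (Rᵀ * R) (Lᵀ * L) (empCentralMoment (sampleMean x) x) a b := by
    simp only [kernelSum]
    rw [Finset.sum_comm, Finset.mul_sum]
    refine Finset.sum_congr rfl fun t _ => ?_
    rw [← Finset.mul_sum, empCentralMoment]
    simp only [Matrix.sub_apply]
    ring
  rw [← h]
  ring

/-- The sums that enter `Q̄ + R̄^N` are the off-diagonal entries of the uncentred, unstandardized FOBI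
matrix. -/
theorem QBar_add_RBar (N : Fin 2) (g : Fin p → Fin q → ℝ) (x : Fin n → Matrix (Fin p) (Fin q) ℝ)
    {k k' : Fin p} (hk : k ≠ k') :
    QBar g x k k' + RBar N x k k' = (1 / (q : ℝ)) *
      (∑ m, ∑ l, ∑ l', empMoment x (some (if N = 0 then k else m, l)) (some (m, l))
          (some (if N = 0 then m else k, l')) (some (k', l'))
        - ∑ l, (g k l * empMoment x none none none (some (k', l)) +
          g k' l * empMoment x none none none (some (k, l)))) := by
  have hq : ∀ k k', qBar g x k k' = (1 / (q : ℝ)) * ∑ l,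
      (empMoment x (some (k, l)) (some (k, l)) (some (k, l)) (some (k', l)) -
        g k l * empMoment x none none none (some (k', l))) := by
    intro k k'
    simp only [qBar, empMoment, entryOrOne, Finset.mul_sum, ← Finset.sum_sub_distrib]
    exact Finset.sum_congr rfl fun l _ => Finset.sum_congr rfl fun i _ => by ring
  have hq3 : ∀ m, qBar₃ x m k k' = (1 / (q : ℝ)) * ∑ l,
      empMoment x (some (if N = 0 then k else m, l)) (some (m, l))
          (some (if N = 0 then m else k, l)) (some (k', l)) := by
    intro m
    simp only [qBar₃, empMoment, entryOrOne, Finset.mul_sum]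
    refine Finset.sum_congr rfl fun l _ => Finset.sum_congr rfl fun i _ => ?_
    split_ifs <;> ring
  have hr3 : ∀ m, rBar₃ N x m k k' = (1 / (q : ℝ)) * ∑ l, ∑ l' ∈ Finset.univ.erase l,
      empMoment x (some (if N = 0 then k else m, l)) (some (m, l))
          (some (if N = 0 then m else k, l')) (some (k', l')) := by
    intro m
    simp only [rBar₃, empMoment, entryOrOne]
    split_ifs
    · rfl
    · simp only [sq]
  have hr1 : rBar x k k' = (1 / (q : ℝ)) * ∑ l, ∑ l' ∈ Finset.univ.erase l,
      empMoment x (some (if N = 0 then k else k, l)) (some (k, l))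
          (some (if N = 0 then k else k, l')) (some (k', l')) := by
    simp only [rBar, empMoment, entryOrOne, ite_self, sq]
  have hr2 : rBar x k' k = (1 / (q : ℝ)) * ∑ l, ∑ l' ∈ Finset.univ.erase l,
      empMoment x (some (if N = 0 then k else k', l)) (some (k', l))
          (some (if N = 0 then k' else k, l')) (some (k', l')) := by
    by_cases hN : N = 0
    · simp only [rBar, empMoment, entryOrOne, hN, if_true]
      congr 1
      rw [Finset.sum_comm' (t' := Finset.univ) (s' := fun l => Finset.univ.erase l)
        (fun a b => by simp [eq_comm])]
      refine Finset.sum_congr rfl fun l _ => Finset.sum_congr rfl fun l' _ => ?_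
      congr 1
      exact Finset.sum_congr rfl fun i _ => by ring
    · simp only [rBar, empMoment, entryOrOne, hN, if_false]
      congr 1
      refine Finset.sum_congr rfl fun l _ => Finset.sum_congr rfl fun l' _ => ?_
      congr 1
      exact Finset.sum_congr rfl fun i _ => by ring
  have hq1 : ∀ m, m = k ∨ m = k' → ∀ l, empMoment x (some (if N = 0 then k else m, l))
      (some (m, l)) (some (if N = 0 then m else k, l)) (some (k', l)) =
      empMoment x (some (m, l)) (some (m, l)) (some (m, l))
        (some (if m = k then k' else k, l)) := by
    intro m hm l
    simp only [empMoment, entryOrOne]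
    congr 1
    refine Finset.sum_congr rfl fun i _ => ?_
    rcases hm with rfl | rfl
    · simp
    · simp only [hk.symm, if_false]
      split_ifs <;> ring
  have hsplit : ∀ m l, ∑ l', empMoment x (some (if N = 0 then k else m, l)) (some (m, l))
      (some (if N = 0 then m else k, l')) (some (k', l')) =
      empMoment x (some (if N = 0 then k else m, l)) (some (m, l))
        (some (if N = 0 then m else k, l)) (some (k', l)) +
      ∑ l' ∈ Finset.univ.erase l, empMoment x (some (if N = 0 then k else m, l)) (some (m, l))
        (some (if N = 0 then m else k, l')) (some (k', l')) :=
    fun m l => (Finset.add_sum_erase _ _ (Finset.mem_univ l)).symm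
  have hk' : k' ∈ Finset.univ.erase k := Finset.mem_erase.2 ⟨hk.symm, Finset.mem_univ _⟩
  simp only [hsplit]
  rw [← Finset.add_sum_erase _ _ (Finset.mem_univ k), ← Finset.add_sum_erase _ _ hk']
  simp only [Finset.sum_add_distrib]
  simp only [hq1 k (Or.inl rfl), hq1 k' (Or.inr rfl), if_true, hk.symm, if_false]
  rw [QBar, RBar, hq, hq, hr1, hr2]
  simp only [hq3, hr3, ← Finset.mul_sum, Finset.sum_sub_distrib]
  ring

end Moments

/-! ### First-order expansion of the left estimate -/

/-- The mixed moments of order at most four of independent standardized entries with third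
moments `γ` and fourth moments `β`. -/
structure HasStandardMoments {p q : ℕ}
    (μ : Option (Fin p × Fin q) → Option (Fin p × Fin q) → Option (Fin p × Fin q) →
      Option (Fin p × Fin q) → ℝ) (γ β : Fin p → Fin q → ℝ) : Prop where
  first : ∀ a, μ none none none (some a) = 0
  second : ∀ a b, μ none none (some a) (some b) = if a = b then 1 else 0
  third : ∀ a b c, μ none (some a) (some b) (some c) = if a = b ∧ a = c then γ a.1 a.2 else 0
  fourth : ∀ a b c d, μ (some a) (some b) (some c) (some d) =
    (if a = b ∧ c = d then 1 else 0) + (if a = c ∧ b = d then 1 else 0) +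
    (if a = d ∧ b = c then 1 else 0) + (if a = b ∧ a = c ∧ a = d then β a.1 a.2 - 3 else 0)

section Estimate

variable {n p q : ℕ}

/-- The left FOBI matrix standardized by the chosen inverse square roots. -/
noncomputable def stdLeftFobi (N : Fin 2) (c : Bool) (x : Fin n → Matrix (Fin p) (Fin q) ℝ) :
    Matrix (Fin p) (Fin p) ℝ :=
  leftFobi N (invSqrt (leftCov c x)) (invSqrt (rightCov c x)) x

/-- A measurable left estimate whose order and signs are chosen so that it is close to the
identity. -/
noncomputable def leftEstimate (N : Fin 2) (c : Bool) (x : Fin n → Matrix (Fin p) (Fin q) ℝ) :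
    Matrix (Fin p) (Fin p) ℝ :=
  (eigvec (stdLeftFobi N c x))ᵀ * invSqrt (leftCov c x)

theorem isLeftEstimate_leftEstimate (N : Fin 2) (c : Bool)
    (x : Fin n → Matrix (Fin p) (Fin q) ℝ) (hL : (leftCov c x).PosDef)
    (hR : (rightCov c x).PosDef) : IsLeftEstimate N c x (leftEstimate N c x) := by
  refine ⟨invSqrt (leftCov c x), invSqrt (rightCov c x), eigvec (stdLeftFobi N c x),
    eigval (stdLeftFobi N c x), isSymmInvSqrt_invSqrt hL, isSymmInvSqrt_invSqrt hR,
    (mem_orthogonalGroup_iff _ _).2 (eigvec_mul_transpose _), ?_, rfl⟩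
  rw [← eigvec_decomp, symmPart_of_symm]
  · rfl
  · exact leftFobi_transpose _ _ _ _

theorem measurable_sample_entry (i : Fin n) (k : Fin p) (l : Fin q) :
    Measurable fun x : Fin n → Matrix (Fin p) (Fin q) ℝ => x i k l :=
  measurable_entry (measurable_pi_apply i) k l

theorem measurable_sampleMean_entry (k : Fin p) (l : Fin q) :
    Measurable fun x : Fin n → Matrix (Fin p) (Fin q) ℝ => sampleMean x k l := by
  simp only [sampleMean, Matrix.smul_apply, Matrix.sum_apply, smul_eq_mul]
  exact (Finset.measurable_sum _ fun i _ => measurable_sample_entry i k l).const_mul _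

theorem measurable_location_entry (c : Bool) (k : Fin p) (l : Fin q) :
    Measurable fun x : Fin n → Matrix (Fin p) (Fin q) ℝ => location c x k l := by
  cases c
  · simp [location]
  · simpa [location] using measurable_sampleMean_entry k l

theorem measurable_leftCov (c : Bool) :
    Measurable (leftCov c : (Fin n → Matrix (Fin p) (Fin q) ℝ) → _) := by
  refine measurable_matrix fun k k' => ?_
  simp only [leftCov_apply]
  refine (Finset.measurable_sum _ fun l _ =>
    (Finset.measurable_sum _ fun i _ => ?_).const_mul _).const_mul _
  exact ((measurable_sample_entry i k l).sub (measurable_location_entry c k l)).mul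
    ((measurable_sample_entry i k' l).sub (measurable_location_entry c k' l))

theorem measurable_rightCov (c : Bool) :
    Measurable (rightCov c : (Fin n → Matrix (Fin p) (Fin q) ℝ) → _) := by
  refine measurable_matrix fun l l' => ?_
  simp only [rightCov_apply]
  refine (Finset.measurable_sum _ fun k _ =>
    (Finset.measurable_sum _ fun i _ => ?_).const_mul _).const_mul _
  exact ((measurable_sample_entry i k l).sub (measurable_location_entry c k l)).mul
    ((measurable_sample_entry i k l').sub (measurable_location_entry c k l'))

theorem measurable_stdLeftFobi (N : Fin 2) (c : Bool) :
    Measurable (stdLeftFobi N c : (Fin n → Matrix (Fin p) (Fin q) ℝ) → _) := by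
  have hL : Measurable fun x : Fin n → Matrix (Fin p) (Fin q) ℝ => invSqrt (leftCov c x) :=
    measurable_invSqrt.comp (measurable_leftCov c)
  have hR : Measurable fun x : Fin n → Matrix (Fin p) (Fin q) ℝ => invSqrt (rightCov c x) :=
    measurable_invSqrt.comp (measurable_rightCov c)
  have hLL := measurable_matrix_mul (measurable_matrix_transpose hL) hL
  have hRR := measurable_matrix_mul (measurable_matrix_transpose hR) hR
  refine measurable_matrix fun k k' => ?_
  simp only [stdLeftFobi, leftFobi_apply, kernelSum]
  refine Finset.measurable_sum _ fun a _ => Finset.measurable_sum _ fun b _ =>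
    ((measurable_entry hL k a).mul (measurable_entry hL k' b)).mul
      ((Finset.measurable_sum _ fun t _ => ?_).const_mul _)
  refine (((measurable_entry hRR _ _).mul (measurable_entry hLL _ _)).mul
    (measurable_entry hRR _ _)).mul ?_
  simp only [empCentralMoment]
  refine (Finset.measurable_sum _ fun i _ => ?_).const_mul _
  have h : ∀ k l, Measurable fun x : Fin n → Matrix (Fin p) (Fin q) ℝ =>
      x i k l - sampleMean x k l := fun k l =>
    (measurable_sample_entry i k l).sub (measurable_sampleMean_entry k l)
  exact (((h _ _).mul (h _ _)).mul (h _ _)).mul (h _ _)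

theorem measurable_leftEstimate (N : Fin 2) (c : Bool) :
    Measurable (leftEstimate N c : (Fin n → Matrix (Fin p) (Fin q) ℝ) → _) :=
  measurable_matrix_mul
    (measurable_matrix_transpose (measurable_eigvec.comp (measurable_stdLeftFobi N c)))
    (measurable_invSqrt.comp (measurable_leftCov c))

end Estimate

section Asymptotic

variable {p q : ℕ} {α : Type*} {l : Filter α} {e : α → ℝ} {n : α → ℕ}
  {x : ∀ t : α, Fin (n t) → Matrix (Fin p) (Fin q) ℝ}
  {μ : Option (Fin p × Fin q) → Option (Fin p × Fin q) → Option (Fin p × Fin q) →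
    Option (Fin p × Fin q) → ℝ} {γ β : Fin p → Fin q → ℝ}

/-- The empirical moments of order at most four of the samples `x t` are within `O(e t)` of `μ`. -/
def MomentsClose (l : Filter α) (e : α → ℝ) (x : ∀ t : α, Fin (n t) → Matrix (Fin p) (Fin q) ℝ)
    (μ : Option (Fin p × Fin q) → Option (Fin p × Fin q) → Option (Fin p × Fin q) →
      Option (Fin p × Fin q) → ℝ) : Prop :=
  ∀ a b c d, (fun t => empMoment (x t) a b c d - μ a b c d) =O[l] e

theorem MomentsClose.empMoment_isBigO_one (hM : MomentsClose l e x μ) (he : Tendsto e l (𝓝 0))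
    (a b c d : Option (Fin p × Fin q)) :
    (fun t => empMoment (x t) a b c d) =O[l] fun _ => (1 : ℝ) :=
  (HasExpansion.of_isBigO (hM a b c d)).isBigO_one he

theorem MomentsClose.mean_isBigO (hM : MomentsClose l e x μ) (hμ : HasStandardMoments μ γ β)
    (a : Fin p × Fin q) : (fun t => empMoment (x t) none none none (some a)) =O[l] e := by
  simpa [hμ.first] using hM none none none (some a)

theorem MomentsClose.location_isBigO (hM : MomentsClose l e x μ) (hμ : HasStandardMoments μ γ β)
    (c : Bool) (a : Fin p × Fin q) : (fun t => location c (x t) a.1 a.2) =O[l] e := by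
  cases c
  · simpa [location] using isBigO_zero e l
  · simpa only [location, if_true, sampleMean_apply] using hM.mean_isBigO hμ a

theorem MomentsClose.covariance_remainder (hM : MomentsClose l e x μ)
    (hμ : HasStandardMoments μ γ β) (he : Tendsto e l (𝓝 0)) (s : Bool) (a b : Fin p × Fin q) :
    (fun t => (1 / (n t : ℝ)) * ∑ i, (x t i a.1 a.2 - location s (x t) a.1 a.2) *
      (x t i b.1 b.2 - location s (x t) b.1 b.2) - empMoment (x t) none none (some a) (some b))
      =O[l] fun t => e t ^ 2 := by
  have h1 := IsBigO.mul_sq (hM.location_isBigO hμ s a) (hM.mean_isBigO hμ b)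
  have h2 := IsBigO.mul_sq (hM.location_isBigO hμ s b) (hM.mean_isBigO hμ a)
  have h3 := (IsBigO.mul_sq (hM.location_isBigO hμ s a) (hM.location_isBigO hμ s b)).mul
    (hM.empMoment_isBigO_one he none none none none)
  simp only [mul_one] at h3
  refine ((h3.sub h1).sub h2).congr_left fun t => ?_
  rw [empCovariance_eq]
  ring

theorem MomentsClose.leftCov_expansion (hM : MomentsClose l e x μ)
    (hμ : HasStandardMoments μ γ β) (he : Tendsto e l (𝓝 0)) (hq : 0 < q) (s : Bool)
    (k k' : Fin p) :
    HasExpansion l e (fun t => leftCov s (x t) k k') ((1 : Matrix (Fin p) (Fin p) ℝ) k k')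
      (fun t => sBar (x t) k k' - (1 : Matrix (Fin p) (Fin p) ℝ) k k') := by
  have hq' : (q : ℝ) ≠ 0 := by positivity
  have h1 : (1 : Matrix (Fin p) (Fin p) ℝ) k k' =
      (1 / (q : ℝ)) * ∑ l, μ none none (some (k, l)) (some (k', l)) := by
    simp [hμ.second, Matrix.one_apply, hq']
  constructor
  · have : ∀ t, sBar (x t) k k' - (1 : Matrix (Fin p) (Fin p) ℝ) k k' = (1 / (q : ℝ)) *
        ∑ l, (empMoment (x t) none none (some (k, l)) (some (k', l)) -
          μ none none (some (k, l)) (some (k', l))) := fun t => by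
      rw [h1, sBar_eq, ← mul_sub, Finset.sum_sub_distrib]
    simp only [this]
    exact (isBigO_sum fun l _ => hM _ _ _ _).const_mul_left _
  · have : ∀ t, leftCov s (x t) k k' - (1 : Matrix (Fin p) (Fin p) ℝ) k k' -
        (sBar (x t) k k' - (1 : Matrix (Fin p) (Fin p) ℝ) k k') = (1 / (q : ℝ)) *
        ∑ j, ((1 / (n t : ℝ)) * ∑ i, (x t i k j - location s (x t) k j) *
          (x t i k' j - location s (x t) k' j) -
            empMoment (x t) none none (some (k, j)) (some (k', j))) := fun t => by
      rw [leftCov_apply, sBar_eq, Finset.sum_sub_distrib]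
      ring
    simp only [this]
    exact (isBigO_sum fun j _ => hM.covariance_remainder hμ he s (k, j) (k', j)).const_mul_left _

theorem MomentsClose.rightCov_sub_one (hM : MomentsClose l e x μ)
    (hμ : HasStandardMoments μ γ β) (he : Tendsto e l (𝓝 0)) (hp : 0 < p) (s : Bool)
    (j j' : Fin q) :
    (fun t => rightCov s (x t) j j' - (1 : Matrix (Fin q) (Fin q) ℝ) j j') =O[l] e := by
  have hp' : (p : ℝ) ≠ 0 := by positivity
  have h1 : (1 : Matrix (Fin q) (Fin q) ℝ) j j' =
      (1 / (p : ℝ)) * ∑ k, μ none none (some (k, j)) (some (k, j')) := by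
    simp [hμ.second, Matrix.one_apply, hp']
  have : ∀ t, rightCov s (x t) j j' - (1 : Matrix (Fin q) (Fin q) ℝ) j j' = (1 / (p : ℝ)) *
      ∑ k, ((1 / (n t : ℝ)) * ∑ i, (x t i k j - location s (x t) k j) *
        (x t i k j' - location s (x t) k j') -
          empMoment (x t) none none (some (k, j)) (some (k, j')) +
        (empMoment (x t) none none (some (k, j)) (some (k, j')) -
          μ none none (some (k, j)) (some (k, j')))) := fun t => by
    rw [rightCov_apply, h1, ← mul_sub, ← Finset.sum_sub_distrib]
    congr 1
    exact Finset.sum_congr rfl fun k _ => by ring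
  simp only [this]
  exact (isBigO_sum fun k _ => ((hM.covariance_remainder hμ he s (k, j) (k, j')).trans
    (sq_isBigO_self he)).add (hM _ _ _ _)).const_mul_left _

/-- The linear part of a centred empirical fourth moment. -/
noncomputable def centralLinear {n : ℕ} (μ : Option (Fin p × Fin q) → Option (Fin p × Fin q) →
    Option (Fin p × Fin q) → Option (Fin p × Fin q) → ℝ)
    (x : Fin n → Matrix (Fin p) (Fin q) ℝ) (a b c d : Fin p × Fin q) : ℝ :=
  empMoment x (some a) (some b) (some c) (some d) - μ (some a) (some b) (some c) (some d)
    - μ none (some b) (some c) (some d) * empMoment x none none none (some a)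
    - μ none (some a) (some c) (some d) * empMoment x none none none (some b)
    - μ none (some a) (some b) (some d) * empMoment x none none none (some c)
    - μ none (some a) (some b) (some c) * empMoment x none none none (some d)

theorem MomentsClose.empCentralMoment_expansion (hM : MomentsClose l e x μ)
    (hμ : HasStandardMoments μ γ β) (he : Tendsto e l (𝓝 0)) (a b c d : Fin p × Fin q) :
    HasExpansion l e (fun t => empCentralMoment (sampleMean (x t)) (x t) a b c d)
      (μ (some a) (some b) (some c) (some d)) (fun t => centralLinear μ (x t) a b c d) := by
  have hu := fun a => hM.mean_isBigO hμ a
  have h1 := hM.empMoment_isBigO_one he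
  have hlin : ∀ a b c d : Fin p × Fin q, (fun t => empMoment (x t) none none none (some a) *
      (empMoment (x t) none (some b) (some c) (some d) - μ none (some b) (some c) (some d)))
      =O[l] fun t => e t ^ 2 := fun a b c d => IsBigO.mul_sq (hu a) (hM _ _ _ _)
  have hquad : ∀ (a b : Fin p × Fin q) (f : α → ℝ), f =O[l] (fun _ => (1 : ℝ)) →
      (fun t => empMoment (x t) none none none (some a) *
        empMoment (x t) none none none (some b) * f t) =O[l] fun t => e t ^ 2 := by
    intro a b f hf
    simpa using (IsBigO.mul_sq (hu a) (hu b)).mul hf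
  have hu1 : ∀ a, (fun t => empMoment (x t) none none none (some a)) =O[l] fun _ => (1 : ℝ) :=
    fun a => h1 _ _ _ _
  have hone : ∀ {f g : α → ℝ}, f =O[l] (fun _ => (1 : ℝ)) → g =O[l] (fun _ => (1 : ℝ)) →
      (fun t => f t * g t) =O[l] fun _ => (1 : ℝ) := fun hf hg => by simpa using hf.mul hg
  constructor
  · refine (((((hM _ _ _ _).sub ((hu a).const_mul_left _)).sub ((hu b).const_mul_left _)).sub
      ((hu c).const_mul_left _)).sub ((hu d).const_mul_left _))
  · have h := ((((((((((((((((hlin a b c d).neg_left.sub (hlin b a c d)).sub (hlin c a b d)).sub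
      (hlin d a b c)).add (hquad a b _ (h1 none none (some c) (some d)))).add
      (hquad a c _ (h1 none none (some b) (some d)))).add
      (hquad a d _ (h1 none none (some b) (some c)))).add
      (hquad b c _ (h1 none none (some a) (some d)))).add
      (hquad b d _ (h1 none none (some a) (some c)))).add
      (hquad c d _ (h1 none none (some a) (some b)))).sub
      (hquad a b _ (hone (hu1 c) (hu1 d)))).sub
      (hquad a b _ (hone (hu1 d) (hu1 c)))).sub
      (hquad a c _ (hone (hu1 d) (hu1 b)))).sub
      (hquad b c _ (hone (hu1 d) (hu1 a)))).add
      (hquad a b _ (hone (hone (hu1 c) (hu1 d)) (h1 none none none none)))))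
    refine h.congr_left fun t => ?_
    rw [empCentralMoment_eq]
    simp only [sampleMean_apply, centralLinear]
    ring

end Asymptotic

section KernelSum

variable {p q : ℕ} {μ : Option (Fin p × Fin q) → Option (Fin p × Fin q) → Option (Fin p × Fin q) →
    Option (Fin p × Fin q) → ℝ} {γ β : Fin p → Fin q → ℝ}

/-- The constant `p + q - 2` for `N = 0` and `p q - 1` for `N = 1`. -/
def fobiShift (N : Fin 2) (p q : ℕ) : ℝ :=
  if N = 0 then (p : ℝ) + q - 2 else (p : ℝ) * q - 1

/-- The coefficient of the left covariance in the linear part of the FOBI matrix. -/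
def covCoeff (N : Fin 2) (q : ℕ) : ℝ := if N = 0 then (q : ℝ) + 1 else 2

theorem fobiShift_add_covCoeff (N : Fin 2) (p q : ℕ) :
    fobiShift N p q + covCoeff N q = bConst N p q := by
  unfold fobiShift covCoeff bConst
  split_ifs <;> ring

theorem kernelSum_one (N : Fin 2)
    (T : Fin p × Fin q → Fin p × Fin q → Fin p × Fin q → Fin p × Fin q → ℝ) (a b : Fin p) :
    kernelSum N 1 1 T a b = ∑ m, ∑ l, ∑ l', T (if N = 0 then a else m, l) (m, l)
      (if N = 0 then m else a, l') (b, l') := by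
  simp [kernelSum, Fintype.sum_prod_type, Matrix.one_apply]
  rw [Finset.sum_comm]
  refine Finset.sum_congr rfl fun m _ => ?_
  rw [Finset.sum_comm]

theorem HasStandardMoments.fourth_eq_zero (hμ : HasStandardMoments μ γ β) (N : Fin 2)
    {a b : Fin p} (hab : a ≠ b) (m : Fin p) (l j j' l' : Fin q) :
    μ (some (if N = 0 then a else m, l)) (some (m, j)) (some (if N = 0 then m else a, j'))
      (some (b, l')) = 0 := by
  rw [hμ.fourth]
  by_cases hN : N = 0
  · simp only [hN, if_true, Prod.mk.injEq]
    rw [if_neg, if_neg, if_neg, if_neg]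
    · norm_num
    all_goals
      rintro ⟨⟨rfl, _⟩, h⟩
      simp_all
  · simp only [hN, if_false, Prod.mk.injEq]
    rw [if_neg, if_neg, if_neg, if_neg]
    · norm_num
    all_goals
      intro h
      grind

theorem HasStandardMoments.sum_fourth (hμ : HasStandardMoments μ γ β) (hq : 0 < q) (N : Fin 2)
    (a b : Fin p) :
    (1 / (q : ℝ)) * kernelSum N 1 1
      (fun a b c d => μ (some a) (some b) (some c) (some d)) a b =
      diagonal (fun a => (1 / (q : ℝ)) * ∑ l, β a l + fobiShift N p q) a b := by
  by_cases hab : a = b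
  · subst hab
    have hq' : (q : ℝ) ≠ 0 := by positivity
    rw [kernelSum_one, diagonal_apply_eq]
    have h : ∑ m, ∑ l, ∑ l', μ (some (if N = 0 then a else m, l)) (some (m, l))
        (some (if N = 0 then m else a, l')) (some (a, l')) =
        ∑ l, β a l + q * fobiShift N p q := by
      simp only [hμ.fourth]
      by_cases hN : N = 0
      · simp [hN, fobiShift, Finset.sum_add_distrib, ite_and, eq_comm]
        ring
      · simp [hN, fobiShift, Finset.sum_add_distrib, ite_and]
        ring
    rw [h]
    field_simp
  · rw [kernelSum_one, diagonal_apply_ne _ hab]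
    simp [hμ.fourth_eq_zero N hab]

theorem HasStandardMoments.sum_fourth_mul (hμ : HasStandardMoments μ γ β) (N : Fin 2)
    {D : Matrix (Fin p) (Fin p) ℝ} (hD : ∀ m m', D m m' = D m' m) {a b : Fin p} (hab : a ≠ b) :
    ∑ l', ∑ m', ∑ m, ∑ l, D m m' * μ (some (if N = 0 then a else m', l)) (some (m, l))
        (some (if N = 0 then m' else a, l')) (some (b, l')) = q * (covCoeff N q * D a b) := by
  simp only [hμ.fourth]
  by_cases hN : N = 0
  · simp [hN, covCoeff, mul_add, hab, Finset.sum_add_distrib, ite_and]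
    rw [hD b a]
    ring
  · simp [hN, covCoeff, mul_add, hab, Finset.sum_add_distrib, ite_and]
    rw [hD b a]
    ring

theorem HasStandardMoments.sum_centralLinear (hμ : HasStandardMoments μ γ β) (N : Fin 2)
    {n : ℕ} (x : Fin n → Matrix (Fin p) (Fin q) ℝ) {a b : Fin p} (hab : a ≠ b) :
    (1 / (q : ℝ)) * kernelSum N 1 1 (centralLinear μ x) a b = QBar γ x a b + RBar N x a b := by
  rw [QBar_add_RBar N γ x hab, kernelSum_one]
  congr 1
  simp only [centralLinear, hμ.fourth_eq_zero N hab, hμ.third, sub_zero, Finset.sum_sub_distrib]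
  by_cases hN : N = 0
  · simp [hN, hab, ite_and, Finset.sum_add_distrib]
    ring
  · simp [hN, hab, ite_and, Finset.sum_add_distrib]
    ring

end KernelSum

section EstimateExpansion

variable {p q : ℕ} {α : Type*} {l : Filter α} {e : α → ℝ} {n : α → ℕ}
  {x : ∀ t : α, Fin (n t) → Matrix (Fin p) (Fin q) ℝ}
  {μ : Option (Fin p × Fin q) → Option (Fin p × Fin q) → Option (Fin p × Fin q) →
    Option (Fin p × Fin q) → ℝ} {γ β : Fin p → Fin q → ℝ}

theorem sBar_comm {n : ℕ} (x : Fin n → Matrix (Fin p) (Fin q) ℝ) (k k' : Fin p) :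
    sBar x k k' = sBar x k' k := by
  simp only [sBar, mul_comm (x _ k _)]

theorem transpose_mul_self_expansion {r : ℕ} (he : Tendsto e l (𝓝 0))
    {L : α → Matrix (Fin r) (Fin r) ℝ} {d : Fin r → Fin r → α → ℝ}
    (hL : ∀ i j, HasExpansion l e (fun t => L t i j) ((1 : Matrix (Fin r) (Fin r) ℝ) i j) (d i j))
    (i j : Fin r) :
    HasExpansion l e (fun t => ((L t)ᵀ * L t) i j) ((1 : Matrix (Fin r) (Fin r) ℝ) i j)
      (fun t => d i j t + d j i t) := by
  have h := HasExpansion.sum Finset.univ fun m _ => (hL m i).mul he (hL m j)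
  simp only [Matrix.mul_apply, Matrix.transpose_apply]
  refine h.congr ?_ ?_
  · simp [Matrix.one_apply, eq_comm]
  · funext t
    simp [Matrix.one_apply, Finset.sum_add_distrib]

theorem MomentsClose.kernelSum_expansion (hM : MomentsClose l e x μ)
    (hμ : HasStandardMoments μ γ β) (he : Tendsto e l (𝓝 0)) (hq : 0 < q) (N : Fin 2)
    {A : α → Matrix (Fin q) (Fin q) ℝ} {M : α → Matrix (Fin p) (Fin p) ℝ}
    {D : α → Matrix (Fin p) (Fin p) ℝ}
    (hA : ∀ j j', (fun t => A t j j' - (1 : Matrix (Fin q) (Fin q) ℝ) j j') =O[l] e)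
    (hMD : ∀ m m', HasExpansion l e (fun t => M t m m') ((1 : Matrix (Fin p) (Fin p) ℝ) m m')
      (fun t => D t m m'))
    (hD : ∀ t m m', D t m m' = D t m' m) (a b : Fin p) :
    ∃ d, HasExpansion l e (fun t => (1 / (q : ℝ)) *
        kernelSum N (A t) (M t) (empCentralMoment (sampleMean (x t)) (x t)) a b)
      (diagonal (fun a => (1 / (q : ℝ)) * ∑ l, β a l + fobiShift N p q) a b) d ∧
      (a ≠ b → ∀ t, d t = QBar γ (x t) a b + RBar N (x t) a b + covCoeff N q * D t a b) := by
  have hq' : (q : ℝ) ≠ 0 := by positivity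
  have hA' := fun j j' => HasExpansion.of_isBigO (hA j j')
  have h := (HasExpansion.sum Finset.univ fun (t : KernelIndex p q) _ =>
    (((hA' t.2.2.2.2.2 t.2.2.2.2.1).mul he (hMD t.2.2.2.1 t.2.2.1)).mul he
      (hA' t.2.1 t.1)).mul he
    (hM.empCentralMoment_expansion hμ he (if N = 0 then a else t.2.2.1, t.2.2.2.2.2)
      (t.2.2.2.1, t.2.2.2.2.1) (if N = 0 then t.2.2.1 else a, t.2.1) (b, t.1))).const_mul
        (1 / (q : ℝ))
  rw [← hμ.sum_fourth hq N a b]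
  refine ⟨_, h, fun hab t => ?_⟩
  rw [← hμ.sum_centralLinear N (x t) hab, Finset.sum_add_distrib, mul_add]
  congr 1
  have h2 : ∀ s : KernelIndex p q, μ (some (if N = 0 then a else s.2.2.1, s.2.2.2.2.2))
      (some (s.2.2.2.1, s.2.2.2.2.1)) (some (if N = 0 then s.2.2.1 else a, s.2.1))
      (some (b, s.1)) *
      ((1 : Matrix (Fin q) (Fin q) ℝ) s.2.2.2.2.2 s.2.2.2.2.1 *
          (1 : Matrix (Fin p) (Fin p) ℝ) s.2.2.2.1 s.2.2.1 *
          (A t s.2.1 s.1 - (1 : Matrix (Fin q) (Fin q) ℝ) s.2.1 s.1) +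
        (1 : Matrix (Fin q) (Fin q) ℝ) s.2.1 s.1 *
          ((1 : Matrix (Fin q) (Fin q) ℝ) s.2.2.2.2.2 s.2.2.2.2.1 * D t s.2.2.2.1 s.2.2.1 +
            (1 : Matrix (Fin p) (Fin p) ℝ) s.2.2.2.1 s.2.2.1 *
              (A t s.2.2.2.2.2 s.2.2.2.2.1 -
                (1 : Matrix (Fin q) (Fin q) ℝ) s.2.2.2.2.2 s.2.2.2.2.1))) =
      (1 : Matrix (Fin q) (Fin q) ℝ) s.2.1 s.1 *
        ((1 : Matrix (Fin q) (Fin q) ℝ) s.2.2.2.2.2 s.2.2.2.2.1 * (D t s.2.2.2.1 s.2.2.1 *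
          μ (some (if N = 0 then a else s.2.2.1, s.2.2.2.2.2))
            (some (s.2.2.2.1, s.2.2.2.2.1)) (some (if N = 0 then s.2.2.1 else a, s.2.1))
            (some (b, s.1)))) := by
    rintro ⟨l', j', m', m, j, l⟩
    simp only
    by_cases hm : m = m'
    · subst hm
      rw [hμ.fourth_eq_zero N hab]
      ring
    · rw [Matrix.one_apply_ne hm]
      ring
  rw [Finset.sum_congr rfl fun s _ => h2 s]
  simp only [Fintype.sum_prod_type]
  have h3 := hμ.sum_fourth_mul N (hD t) hab
  simp only [Matrix.one_apply, ite_mul, one_mul, zero_mul, Finset.sum_ite_eq',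
    Finset.mem_univ, if_true, Finset.sum_ite_irrel, Finset.sum_const_zero]
  rw [h3]
  field_simp

theorem MomentsClose.invSqrt_leftCov_expansion (hM : MomentsClose l e x μ)
    (hμ : HasStandardMoments μ γ β) (he : Tendsto e l (𝓝 0)) (hq : 0 < q) (c : Bool)
    (k k' : Fin p) :
    HasExpansion l e (fun t => invSqrt (leftCov c (x t)) k k')
      ((1 : Matrix (Fin p) (Fin p) ℝ) k k')
      (fun t => -(1 / 2) * (sBar (x t) k k' - (1 : Matrix (Fin p) (Fin p) ℝ) k k')) := by
  have hS := hM.leftCov_expansion hμ he hq c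
  refine (invSqrt_expansion he (fun t => leftCov_transpose c (x t))
    (fun i j => (hS i j).sub_const he) k k').linear_congr ?_ ((hS k k').linear.const_mul_left _)
  refine ((hS k k').remainder.const_mul_left (-(1 / 2))).congr_left fun t => ?_
  ring

theorem MomentsClose.stdLeftFobi_expansion (hM : MomentsClose l e x μ)
    (hμ : HasStandardMoments μ γ β) (he : Tendsto e l (𝓝 0)) (hp : 0 < p) (hq : 0 < q)
    (N : Fin 2) (c : Bool) {b : Fin p → ℝ}
    (hb : ∀ a, b a = (1 / (q : ℝ)) * ∑ l, β a l + fobiShift N p q) (k k' : Fin p) :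
    ∃ d, HasExpansion l e (fun t => stdLeftFobi N c (x t) k k') (diagonal b k k') d ∧
      (k ≠ k' → ∀ t, d t = QBar γ (x t) k k' + RBar N (x t) k k' -
        (covCoeff N q + (b k + b k') / 2) * sBar (x t) k k') := by
  obtain rfl : b = fun a => (1 / (q : ℝ)) * ∑ l, β a l + fobiShift N p q := funext hb
  have hL := hM.invSqrt_leftCov_expansion hμ he hq c
  have hLL := transpose_mul_self_expansion he hL
  have hR := invSqrt_expansion he (fun t => rightCov_transpose c (x t))
    (hM.rightCov_sub_one hμ he hp c)
  have hRR := fun j j' => (transpose_mul_self_expansion he hR j j').sub_const he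
  choose dK hK hK' using hM.kernelSum_expansion hμ he hq N (D := fun t => Matrix.of fun m m' =>
    -(1 / 2) * (sBar (x t) m m' - (1 : Matrix (Fin p) (Fin p) ℝ) m m') +
      -(1 / 2) * (sBar (x t) m' m - (1 : Matrix (Fin p) (Fin p) ℝ) m' m)) hRR hLL
    (fun t m m' => by simp only [Matrix.of_apply]; ring)
  have h := HasExpansion.sum Finset.univ fun a _ => HasExpansion.sum Finset.univ fun a' _ =>
    ((hL k a).mul he (hL k' a')).mul he (hK a a')
  refine ⟨_, (h.congr ?_ rfl).congr_left (Eventually.of_forall fun t => ?_), fun hk t => ?_⟩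
  · by_cases hk : k = k'
    · subst hk; simp [Matrix.one_apply]
    · simp [Matrix.one_apply, diagonal_apply_ne _ hk]
  · simp only [stdLeftFobi, leftFobi_apply]
  · have hk' := hk.symm
    simp only [Finset.sum_add_distrib]
    simp only [Matrix.one_apply, diagonal_apply, ite_mul, one_mul, zero_mul, mul_add,
      mul_ite, mul_zero, Finset.sum_ite_eq, Finset.sum_ite_eq', Finset.mem_univ, if_true,
      Finset.sum_add_distrib, Finset.sum_ite_irrel, Finset.sum_const_zero, hk, hk', if_false]
    rw [hK' k k' hk t, sBar_comm (x t) k' k]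
    simp only [Matrix.of_apply, Matrix.one_apply_ne hk, Matrix.one_apply_ne hk',
      sBar_comm (x t) k' k]
    ring

theorem MomentsClose.leftEstimate_expansion (hM : MomentsClose l e x μ)
    (hμ : HasStandardMoments μ γ β) (he : Tendsto e l (𝓝 0)) (hp : 0 < p) (hq : 0 < q)
    (N : Fin 2) (c : Bool) {κ : Fin p → ℝ} (hκ : ∀ a, κ a = (1 / (q : ℝ)) * ∑ l, β a l)
    (hinj : Function.Injective κ) (k k' : Fin p) :
    HasExpansion l e (fun t => leftEstimate N c (x t) k k')
      ((1 : Matrix (Fin p) (Fin p) ℝ) k k')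
      (fun t => if k = k' then -(1 / 2) * (sBar (x t) k k - 1) else
        (QBar γ (x t) k k' + RBar N (x t) k k' -
          (κ k + bConst N p q) * sBar (x t) k k') / (κ k - κ k')) := by
  have hL := hM.invSqrt_leftCov_expansion hμ he hq c
  obtain ⟨b, hbdef⟩ : ∃ b : Fin p → ℝ, ∀ a, b a = κ a + fobiShift N p q := ⟨_, fun _ => rfl⟩
  have hbinj : Function.Injective b := fun i j hij => hinj (by
    rw [hbdef, hbdef] at hij; linarith)
  choose dB hB hB' using hM.stdLeftFobi_expansion hμ he hp hq N c (b := b)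
    (fun a => by rw [hbdef, hκ])
  have hW := eigvec_expansion he hbinj
    (fun t => leftFobi_transpose N (invSqrt (leftCov c (x t))) (invSqrt (rightCov c (x t))) (x t))
    (fun i j => (hB i j).sub_const he)
  have hW' : ∀ i j, HasExpansion l e (fun t => eigvec (stdLeftFobi N c (x t)) i j)
      ((1 : Matrix (Fin p) (Fin p) ℝ) i j)
      (fun t => if i = j then 0 else dB j i t / (b j - b i)) := by
    intro i j
    refine (hW i j).linear_congr ?_ ?_
    · by_cases hij : i = j
      · simpa [hij] using isBigO_zero (fun t => e t ^ 2) l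
      · have hji : j ≠ i := fun h => hij h.symm
        refine ((hB j i).remainder.const_mul_left (b j - b i)⁻¹).congr_left fun t => ?_
        have hs : stdLeftFobi N c (x t) j i = stdLeftFobi N c (x t) i j :=
          congrFun (congrFun (leftFobi_transpose N _ _ (x t)) i) j
        rw [hs, diagonal_apply_ne _ hji]
        simp only [if_neg hij, stdLeftFobi]
        ring
    · by_cases hij : i = j
      · simpa [hij] using isBigO_zero e l
      · refine ((hB j i).linear.const_mul_left (b j - b i)⁻¹).congr_left fun t => ?_
        simp only [if_neg hij]
        ring
  have h := HasExpansion.sum Finset.univ fun m _ => (hW' m k).mul he (hL m k')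
  refine HasExpansion.congr (h.congr_left (Eventually.of_forall fun t => ?_)) ?_ ?_
  · simp only [leftEstimate, Matrix.mul_apply, Matrix.transpose_apply]
  · simp [Matrix.one_apply, eq_comm]
  · funext t
    by_cases hk : k = k'
    · subst hk
      rw [Finset.sum_eq_single k]
      · simp
      · intro m _ hm
        simp [Matrix.one_apply_ne hm]
      · simp
    · have hk' : k' ≠ k := fun h' => hk h'.symm
      have hne : κ k - κ k' ≠ 0 := fun h0 => hk (hinj (sub_eq_zero.1 h0))
      have hbb : b k - b k' = κ k - κ k' := by rw [hbdef, hbdef]; ring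
      simp only [Matrix.one_apply, ite_mul, one_mul, zero_mul, Finset.sum_add_distrib,
        Finset.sum_ite_eq', Finset.mem_univ, if_true, if_neg hk, if_neg hk', hB' k k' hk t, hbb]
      rw [← fobiShift_add_covCoeff, hbdef, hbdef]
      field_simp
      ring

end EstimateExpansion

/-! ### Population moments -/

section PopulationMoments

variable {Ω : Type*} [MeasurableSpace Ω] {P : Measure Ω} {p q : ℕ}

/-- The population mean of a product of four (extended) entries. -/
noncomputable def popMoment (P : Measure Ω) (Z : Ω → Matrix (Fin p) (Fin q) ℝ)
    (a b c d : Option (Fin p × Fin q)) : ℝ :=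
  ∫ ω, entryOrOne (Z ω) a * entryOrOne (Z ω) b * entryOrOne (Z ω) c * entryOrOne (Z ω) d ∂P

section Monomials

variable {ι : Type*} [Fintype ι] {X : ι → Ω → ℝ}

theorem integral_monomial (hX : iIndepFun X P) (hm : ∀ i, Measurable (X i)) (s : ι → ℕ) :
    ∫ ω, ∏ i, X i ω ^ s i ∂P = ∏ i, ∫ ω, X i ω ^ s i ∂P :=
  hX.integral_fun_prod_comp (f := fun i y => y ^ s i) (fun i => (hm i).aemeasurable)
    (fun i => (measurable_id.pow_const (s i)).aestronglyMeasurable)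

theorem integral_monomial_eq_zero (hX : iIndepFun X P) (hm : ∀ i, Measurable (X i))
    (h1 : ∀ i, ∫ ω, X i ω ∂P = 0) {s : ι → ℕ} (i : ι) (hs : s i = 1) :
    ∫ ω, ∏ i, X i ω ^ s i ∂P = 0 := by
  rw [integral_monomial hX hm]
  refine Finset.prod_eq_zero (Finset.mem_univ i) ?_
  simpa [hs] using h1 i

theorem integral_monomial_eq_one [IsProbabilityMeasure P] (hX : iIndepFun X P)
    (hm : ∀ i, Measurable (X i)) (h2 : ∀ i, ∫ ω, X i ω ^ 2 ∂P = 1) {s : ι → ℕ}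
    (hs : ∀ i, s i = 0 ∨ s i = 2) : ∫ ω, ∏ i, X i ω ^ s i ∂P = 1 := by
  rw [integral_monomial hX hm]
  refine Finset.prod_eq_one fun i _ => ?_
  rcases hs i with h | h
  · simp [h]
  · simpa [h] using h2 i

end Monomials

variable {Z : Ω → Matrix (Fin p) (Fin q) ℝ}

theorem prod_pow_ite {ι : Type*} [Fintype ι] [DecidableEq ι] (X : ι → ℝ) (a : ι) :
    ∏ i, X i ^ (if a = i then 1 else 0) = X a := by
  simp [pow_ite]

theorem StandardizedIndependent.integral_sq (h : StandardizedIndependent P Z) (hm : Measurable Z)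
    (k : Fin p) (l : Fin q) : ∫ ω, Z ω k l ^ 2 ∂P = 1 := by
  rw [← h.variance_one k l, variance_of_integral_eq_zero (measurable_entry hm k l).aemeasurable
    (h.mean_zero k l)]

theorem StandardizedIndependent.hasStandardMoments [IsProbabilityMeasure P]
    (h : StandardizedIndependent P Z)
    (hm : Measurable Z) : HasStandardMoments (popMoment P Z) (skew P Z) (kurt P Z) := by
  have hX := h.indep
  have hmX : ∀ a : Fin p × Fin q, Measurable fun ω => Z ω a.1 a.2 :=
    fun a => measurable_entry hm a.1 a.2
  have h1 : ∀ a : Fin p × Fin q, ∫ ω, Z ω a.1 a.2 ∂P = 0 := fun a => h.mean_zero a.1 a.2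
  have h2 : ∀ a : Fin p × Fin q, ∫ ω, Z ω a.1 a.2 ^ 2 ∂P = 1 :=
    fun a => h.integral_sq hm a.1 a.2
  have hzero : ∀ {s : Fin p × Fin q → ℕ} (i : Fin p × Fin q), s i = 1 →
      ∫ ω, ∏ i, Z ω i.1 i.2 ^ s i ∂P = 0 := fun i hs => integral_monomial_eq_zero hX hmX h1 i hs
  have hone : ∀ {s : Fin p × Fin q → ℕ}, (∀ i, s i = 0 ∨ s i = 2) →
      ∫ ω, ∏ i, Z ω i.1 i.2 ^ s i ∂P = 1 := fun hs => integral_monomial_eq_one hX hmX h2 hs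
  have hprod := fun (ω : Ω) (a : Fin p × Fin q) => prod_pow_ite (fun i : Fin p × Fin q =>
    Z ω i.1 i.2) a
  constructor
  · intro a
    simpa [popMoment, entryOrOne] using h1 a
  · intro a b
    have he : popMoment P Z none none (some a) (some b) = ∫ ω, ∏ i : Fin p × Fin q,
        Z ω i.1 i.2 ^ ((if a = i then 1 else 0) + (if b = i then 1 else 0)) ∂P := by
      simp only [pow_add, Finset.prod_mul_distrib, hprod, popMoment, entryOrOne, one_mul]
    by_cases hab : a = b
    · subst hab
      simp only [popMoment, entryOrOne, one_mul, if_true]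
      simpa only [sq] using h2 a
    · rw [he, if_neg hab]
      exact hzero a (by simp [Ne.symm hab])
  · intro a b c
    have he : popMoment P Z none (some a) (some b) (some c) = ∫ ω, ∏ i : Fin p × Fin q,
        Z ω i.1 i.2 ^ ((if a = i then 1 else 0) + (if b = i then 1 else 0) +
          (if c = i then 1 else 0)) ∂P := by
      simp only [pow_add, Finset.prod_mul_distrib, hprod, popMoment, entryOrOne, one_mul]
    by_cases hab : a = b
    · subst hab
      by_cases hac : a = c
      · subst hac
        simp only [popMoment, entryOrOne, one_mul, and_self, if_true, skew]
        exact integral_congr_ae (Eventually.of_forall fun ω => by ring)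
      · rw [he, if_neg (by simp [hac])]
        exact hzero c (by simp [hac])
    · rw [he, if_neg (by simp [hab])]
      by_cases hac : a = c
      · exact hzero b (by subst hac; simp [hab])
      · exact hzero a (by simp [Ne.symm hab, Ne.symm hac])
  · intro a b c d
    have he : popMoment P Z (some a) (some b) (some c) (some d) = ∫ ω, ∏ i : Fin p × Fin q,
        Z ω i.1 i.2 ^ ((if a = i then 1 else 0) + (if b = i then 1 else 0) +
          (if c = i then 1 else 0) + (if d = i then 1 else 0)) ∂P := by
      simp only [pow_add, Finset.prod_mul_distrib, hprod, popMoment, entryOrOne]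
    by_cases hab : a = b
    · subst hab
      by_cases hac : a = c
      · subst hac
        by_cases had : a = d
        · subst had
          have hk : popMoment P Z (some a) (some a) (some a) (some a) = kurt P Z a.1 a.2 := by
            simp only [popMoment, entryOrOne, kurt]
            exact integral_congr_ae (Eventually.of_forall fun ω => by ring)
          rw [hk]
          simp only [and_self, if_true]
          ring
        · rw [he, hzero d (by simp [had])]
          simp [had]
      · by_cases hcd : c = d
        · subst hcd
          rw [he, hone]
          · simp [hac]
          · intro i
            by_cases hai : a = i
            · subst hai; simp [Ne.symm hac]
            · by_cases hci : c = i <;> simp [hai, hci]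
        · rw [he, hzero c (by simp [hac, Ne.symm hcd])]
          simp [hac, hcd]
    · by_cases hac : a = c
      · subst hac
        by_cases hbd : b = d
        · subst hbd
          rw [he, hone]
          · simp [hab]
          · intro i
            by_cases hai : a = i
            · subst hai; simp [Ne.symm hab]
            · by_cases hci : b = i <;> simp [hai, hci]
        · rw [he, hzero b (by simp [hab, Ne.symm hbd])]
          simp [hab, hbd, Ne.symm hab]
      · by_cases had : a = d
        · subst had
          by_cases hbc : b = c
          · subst hbc
            rw [he, hone]
            · simp [hab]
            · intro i
              by_cases hai : a = i
              · subst hai; simp [Ne.symm hab]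
              · by_cases hci : b = i <;> simp [hai, hci]
          · rw [he, hzero b (by simp [hab, Ne.symm hbc])]
            simp [hab, hbc, hac]
        · rw [he, hzero a (by simp [Ne.symm hab, Ne.symm hac, Ne.symm had])]
          simp [hab, hac, had]

end PopulationMoments

/-! ### Rate of convergence of the empirical moments -/

section Rate

variable {Ω : Type*} [MeasurableSpace Ω] {P : Measure Ω} [IsProbabilityMeasure P] {p q : ℕ}

theorem measurable_entryOrOne (a : Option (Fin p × Fin q)) :
    Measurable fun z : Matrix (Fin p) (Fin q) ℝ => entryOrOne z a := by
  cases a with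
  | none => exact measurable_const
  | some a => exact measurable_entry measurable_id a.1 a.2

/-- A product of four (extended) entries. -/
def monomial (t : Option (Fin p × Fin q) × Option (Fin p × Fin q) × Option (Fin p × Fin q) ×
    Option (Fin p × Fin q)) (z : Matrix (Fin p) (Fin q) ℝ) : ℝ :=
  entryOrOne z t.1 * entryOrOne z t.2.1 * entryOrOne z t.2.2.1 * entryOrOne z t.2.2.2

theorem measurable_monomial (t : Option (Fin p × Fin q) × Option (Fin p × Fin q) ×
    Option (Fin p × Fin q) × Option (Fin p × Fin q)) : Measurable (monomial t) :=
  (((measurable_entryOrOne _).mul (measurable_entryOrOne _)).mul (measurable_entryOrOne _)).mul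
    (measurable_entryOrOne _)

theorem memLp_monomial {Z : Ω → Matrix (Fin p) (Fin q) ℝ}
    (h : ∀ k l, MemLp (fun ω => Z ω k l) 8 P)
    (t : Option (Fin p × Fin q) × Option (Fin p × Fin q) × Option (Fin p × Fin q) ×
      Option (Fin p × Fin q)) : MemLp (fun ω => monomial t (Z ω)) 2 P := by
  have h8 : ∀ a, MemLp (fun ω => entryOrOne (Z ω) a) 8 P := by
    intro a
    cases a with
    | none => exact memLp_const 1
    | some a => exact h a.1 a.2
  have t84 : ENNReal.HolderTriple 8 8 4 := ⟨by
    rw [← ENNReal.toReal_eq_toReal_iff' (by norm_num) (by norm_num),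
      ENNReal.toReal_add (by norm_num) (by norm_num)]
    norm_num⟩
  have t42 : ENNReal.HolderTriple 4 4 2 := ⟨by
    rw [← ENNReal.toReal_eq_toReal_iff' (by norm_num) (by norm_num),
      ENNReal.toReal_add (by norm_num) (by norm_num)]
    norm_num⟩
  have h4 : ∀ a b, MemLp (fun ω => entryOrOne (Z ω) a * entryOrOne (Z ω) b) 4 P :=
    fun a b => (h8 b).mul' (h8 a)
  have h2 := (h4 t.2.2.1 t.2.2.2).mul' (r := 2) (h4 t.1 t.2.1)
  simpa only [monomial, mul_assoc] using h2

/-- The total deviation of the empirical moments from `μ`. -/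
noncomputable def momentError {n : ℕ} (μ : Option (Fin p × Fin q) → Option (Fin p × Fin q) →
    Option (Fin p × Fin q) → Option (Fin p × Fin q) → ℝ)
    (x : Fin n → Matrix (Fin p) (Fin q) ℝ) : ℝ :=
  ∑ t : Option (Fin p × Fin q) × Option (Fin p × Fin q) × Option (Fin p × Fin q) ×
    Option (Fin p × Fin q), |empMoment x t.1 t.2.1 t.2.2.1 t.2.2.2 - μ t.1 t.2.1 t.2.2.1 t.2.2.2|

theorem measure_empMoment_ge {Z : ℕ → Ω → Matrix (Fin p) (Fin q) ℝ}
    (hindep : iIndepFun Z P)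
    (hident : ∀ i, IdentDistrib (Z i) (Z 0) P P)
    (hmoment : ∀ k l, MemLp (fun ω => Z 0 ω k l) 8 P)
    (t : Option (Fin p × Fin q) × Option (Fin p × Fin q) × Option (Fin p × Fin q) ×
      Option (Fin p × Fin q)) {n : ℕ} (hn : 0 < n) {ε : ℝ} (hε : 0 < ε) :
    P {ω | ε ≤ |empMoment (firstObs Z n ω) t.1 t.2.1 t.2.2.1 t.2.2.2 -
      popMoment P (Z 0) t.1 t.2.1 t.2.2.1 t.2.2.2|} ≤
      ENNReal.ofReal (Var[fun ω => monomial t (Z 0 ω); P] / (n * ε ^ 2)) := by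
  have hn' : (n : ℝ) ≠ 0 := by positivity
  have hid : ∀ i, IdentDistrib (fun ω => monomial t (Z i ω)) (fun ω => monomial t (Z 0 ω)) P P :=
    fun i => (hident i).comp (measurable_monomial t)
  have hL : ∀ i, MemLp (fun ω => monomial t (Z i ω)) 2 P :=
    fun i => (hid i).memLp_iff.2 (memLp_monomial hmoment t)
  let Y : Fin n → Ω → ℝ := fun i ω => monomial t (Z i ω)
  have hYL : ∀ i ∈ (Finset.univ : Finset (Fin n)), MemLp (Y i) 2 P := fun i _ => hL i
  have hvar : Var[∑ i, Y i; P] = n * Var[fun ω => monomial t (Z 0 ω); P] := by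
    rw [IndepFun.variance_sum hYL]
    · have : ∀ i : Fin n, Var[Y i; P] = Var[fun ω => monomial t (Z 0 ω); P] :=
        fun i => (hid i).variance_eq
      simp [this]
    · intro i _ j _ hij
      exact (hindep.indepFun (fun h => hij (Fin.ext h))).comp (measurable_monomial t)
        (measurable_monomial t)
  let S : Ω → ℝ := fun ω => (1 / (n : ℝ)) * (∑ i, Y i) ω
  have hS : MemLp S 2 P := (memLp_finsetSum' _ hYL).const_mul _
  have hSvar : Var[S; P] = Var[fun ω => monomial t (Z 0 ω); P] / n := by
    rw [variance_const_mul, hvar]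
    field_simp
  have hSint : ∫ ω, S ω ∂P = popMoment P (Z 0) t.1 t.2.1 t.2.2.1 t.2.2.2 := by
    have : ∀ i : Fin n, ∫ ω, Y i ω ∂P = popMoment P (Z 0) t.1 t.2.1 t.2.2.1 t.2.2.2 :=
      fun i => (hid i).integral_eq
    simp only [S, Finset.sum_apply]
    rw [integral_const_mul, integral_finsetSum (f := Y) _ fun i hi =>
      (hYL i hi).integrable one_le_two]
    simp only [this]
    simp
    field_simp
  have h := meas_ge_le_variance_div_sq hS hε
  rw [hSvar, hSint, div_div] at h
  refine le_trans (le_of_eq ?_) h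
  congr 1
  ext ω
  simp [S, Y, empMoment, monomial, firstObs]

theorem exists_measure_momentError_ge {Z : ℕ → Ω → Matrix (Fin p) (Fin q) ℝ}
    (hindep : iIndepFun Z P)
    (hident : ∀ i, IdentDistrib (Z i) (Z 0) P P)
    (hmoment : ∀ k l, MemLp (fun ω => Z 0 ω k l) 8 P) :
    ∃ C : ℝ, ∀ n : ℕ, 0 < n → ∀ ε : ℝ, 0 < ε →
      P {ω | ε ≤ momentError (popMoment P (Z 0)) (firstObs Z n ω)} ≤
        ENNReal.ofReal (C / (n * ε ^ 2)) := by
  let ι := Option (Fin p × Fin q) × Option (Fin p × Fin q) × Option (Fin p × Fin q) ×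
      Option (Fin p × Fin q)
  have hK : 0 < (Fintype.card ι : ℝ) := by
    exact_mod_cast Fintype.card_pos_iff.2 ⟨((none, none, none, none) : ι)⟩
  refine ⟨(∑ t : ι, Var[fun ω => monomial t (Z 0 ω); P]) * (Fintype.card ι : ℝ) ^ 2,
    fun n hn ε hε => ?_⟩
  have hsub : {ω | ε ≤ momentError (popMoment P (Z 0)) (firstObs Z n ω)} ⊆
      ⋃ t ∈ (Finset.univ : Finset ι), {ω | ε / Fintype.card ι ≤
        |empMoment (firstObs Z n ω) t.1 t.2.1 t.2.2.1 t.2.2.2 -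
          popMoment P (Z 0) t.1 t.2.1 t.2.2.1 t.2.2.2|} := by
    intro ω hω
    by_contra hcon
    simp only [Set.mem_iUnion, Finset.mem_univ, Set.mem_ofPred_eq, exists_prop, true_and,
      not_exists, not_le] at hcon
    have h1 : momentError (popMoment P (Z 0)) (firstObs Z n ω) < ∑ _t : ι, ε / Fintype.card ι :=
      Finset.sum_lt_sum_of_nonempty ⟨(none, none, none, none), Finset.mem_univ _⟩
        fun t _ => hcon t
    rw [Finset.sum_const, Finset.card_univ, nsmul_eq_mul, mul_div_cancel₀ _ hK.ne'] at h1
    exact absurd hω (not_le.2 h1)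
  refine (measure_mono hsub).trans ((measure_biUnion_finset_le _ _).trans ?_)
  have hnn : ∀ t : ι, 0 ≤ Var[fun ω => monomial t (Z 0 ω); P] := fun t => variance_nonneg _ _
  calc _ ≤ ∑ t : ι, ENNReal.ofReal (Var[fun ω => monomial t (Z 0 ω); P] /
        (n * (ε / Fintype.card ι) ^ 2)) :=
        Finset.sum_le_sum fun t _ =>
          measure_empMoment_ge hindep hident hmoment t hn (by positivity)
    _ = ENNReal.ofReal (∑ t : ι, Var[fun ω => monomial t (Z 0 ω); P] /
        (n * (ε / Fintype.card ι) ^ 2)) :=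
        (ENNReal.ofReal_sum_of_nonneg fun t _ => div_nonneg (hnn t) (by positivity)).symm
    _ = _ := by
        rw [← Finset.sum_div]
        congr 1
        have : (n : ℝ) ≠ 0 := by positivity
        field_simp

end Rate

/-! ### From deterministic expansions to stochastic ones -/

section Transfer

variable {Ω : Type*} [MeasurableSpace Ω] {P : Measure Ω} {p q : ℕ}

/-- The filter of samples whose empirical moments of order at most four converge to `μ`. -/
noncomputable def momentFilter (μ : Option (Fin p × Fin q) → Option (Fin p × Fin q) → Option (Fin p × Fin q) →
    Option (Fin p × Fin q) → ℝ) : Filter (Σ n : ℕ, Fin n → Matrix (Fin p) (Fin q) ℝ) :=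
  comap (fun t => momentError μ t.2) (𝓝 0)

theorem momentError_nonneg {n : ℕ} (μ : Option (Fin p × Fin q) → Option (Fin p × Fin q) →
    Option (Fin p × Fin q) → Option (Fin p × Fin q) → ℝ)
    (x : Fin n → Matrix (Fin p) (Fin q) ℝ) : 0 ≤ momentError μ x :=
  Finset.sum_nonneg fun _ _ => abs_nonneg _

theorem momentsClose_momentFilter (μ : Option (Fin p × Fin q) → Option (Fin p × Fin q) →
    Option (Fin p × Fin q) → Option (Fin p × Fin q) → ℝ) :
    MomentsClose (momentFilter μ) (fun t => momentError μ t.2) (fun t => t.2) μ := by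
  intro a b c d
  refine IsBigO.of_bound 1 (Eventually.of_forall fun t => ?_)
  rw [Real.norm_eq_abs, Real.norm_eq_abs, one_mul, abs_of_nonneg (momentError_nonneg μ t.2)]
  have h := Finset.single_le_sum (s := Finset.univ) (f := fun s : Option (Fin p × Fin q) ×
      Option (Fin p × Fin q) × Option (Fin p × Fin q) × Option (Fin p × Fin q) =>
      |empMoment t.2 s.1 s.2.1 s.2.2.1 s.2.2.2 - μ s.1 s.2.1 s.2.2.1 s.2.2.2|)
    (fun s _ => abs_nonneg (empMoment t.2 s.1 s.2.1 s.2.2.1 s.2.2.2 -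
      μ s.1 s.2.1 s.2.2.1 s.2.2.2)) (Finset.mem_univ (a, b, c, d))
  exact h

theorem eventually_momentFilter {μ : Option (Fin p × Fin q) → Option (Fin p × Fin q) →
    Option (Fin p × Fin q) → Option (Fin p × Fin q) → ℝ}
    {A : (Σ n : ℕ, Fin n → Matrix (Fin p) (Fin q) ℝ) → Prop} (hA : ∀ᶠ t in momentFilter μ, A t) :
    ∃ η > 0, ∀ t, momentError μ t.2 < η → A t := by
  obtain ⟨s, hs, hsub⟩ := mem_comap.1 hA
  obtain ⟨η, hη, hball⟩ := Metric.mem_nhds_iff.1 hs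
  refine ⟨η, hη, fun t ht => hsub (hball ?_)⟩
  rw [Metric.mem_ball, Real.dist_eq, sub_zero, abs_of_nonneg (momentError_nonneg μ t.2)]
  exact ht

variable {Z : ℕ → Ω → Matrix (Fin p) (Fin q) ℝ} {μ : Option (Fin p × Fin q) →
    Option (Fin p × Fin q) → Option (Fin p × Fin q) → Option (Fin p × Fin q) → ℝ} {C : ℝ}

theorem tendsto_measure_momentError_ge
    (hC : ∀ n : ℕ, 0 < n → ∀ ε : ℝ, 0 < ε → P {ω | ε ≤ momentError μ (firstObs Z n ω)} ≤
      ENNReal.ofReal (C / (n * ε ^ 2))) {ε : ℕ → ℝ} (hε : ∀ n, 0 < n → 0 < ε n)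
    (hlim : Tendsto (fun n : ℕ => n * ε n ^ 2) atTop atTop) :
    Tendsto (fun n => P {ω | ε n ≤ momentError μ (firstObs Z n ω)}) atTop (𝓝 0) := by
  have h1 : Tendsto (fun n : ℕ => ENNReal.ofReal (C / (n * ε n ^ 2))) atTop (𝓝 0) := by
    have := ENNReal.tendsto_ofReal (hlim.const_div_atTop C)
    simpa using this
  refine tendsto_of_tendsto_of_tendsto_of_le_of_le' tendsto_const_nhds h1
    (Eventually.of_forall fun _ => zero_le) ?_
  filter_upwards [eventually_gt_atTop 0] with n hn using hC n hn _ (hε n hn)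

theorem tendsto_measure_momentError_ge_const
    (hC : ∀ n : ℕ, 0 < n → ∀ ε : ℝ, 0 < ε → P {ω | ε ≤ momentError μ (firstObs Z n ω)} ≤
      ENNReal.ofReal (C / (n * ε ^ 2))) {η : ℝ} (hη : 0 < η) :
    Tendsto (fun n => P {ω | η ≤ momentError μ (firstObs Z n ω)}) atTop (𝓝 0) :=
  tendsto_measure_momentError_ge hC (fun _ _ => hη)
    (tendsto_natCast_atTop_atTop.atTop_mul_const (by positivity))

theorem tendsto_measure_of_eventually [IsProbabilityMeasure P]
    (hC : ∀ n : ℕ, 0 < n → ∀ ε : ℝ, 0 < ε → P {ω | ε ≤ momentError μ (firstObs Z n ω)} ≤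
      ENNReal.ofReal (C / (n * ε ^ 2)))
    {A : (Σ n : ℕ, Fin n → Matrix (Fin p) (Fin q) ℝ) → Prop} (hA : ∀ᶠ t in momentFilter μ, A t) :
    Tendsto (fun n => P {ω | A ⟨n, firstObs Z n ω⟩}) atTop (𝓝 1) := by
  obtain ⟨η, hη, h⟩ := eventually_momentFilter hA
  have h0 := tendsto_measure_momentError_ge_const hC hη
  have h1 : Tendsto (fun n => 1 - P {ω | η ≤ momentError μ (firstObs Z n ω)}) atTop (𝓝 1) := by
    have := ENNReal.Tendsto.sub (tendsto_const_nhds (x := (1 : ENNReal))) h0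
      (Or.inl ENNReal.one_ne_top)
    simpa using this
  refine tendsto_of_tendsto_of_tendsto_of_le_of_le h1 tendsto_const_nhds (fun n => ?_)
    fun n => prob_le_one
  rw [tsub_le_iff_right, ← measure_univ (μ := P)]
  refine (measure_mono fun ω _ => ?_).trans (measure_union_le _ _)
  by_cases hω : momentError μ (firstObs Z n ω) < η
  · exact Or.inl (h ⟨n, firstObs Z n ω⟩ hω)
  · exact Or.inr (not_lt.1 hω)

theorem tendstoInMeasure_of_tendsto
    (hC : ∀ n : ℕ, 0 < n → ∀ ε : ℝ, 0 < ε → P {ω | ε ≤ momentError μ (firstObs Z n ω)} ≤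
      ENNReal.ofReal (C / (n * ε ^ 2)))
    {f : (Σ n : ℕ, Fin n → Matrix (Fin p) (Fin q) ℝ) → ℝ} {a : ℝ}
    (hf : Tendsto f (momentFilter μ) (𝓝 a)) :
    TendstoInMeasure P (fun n ω => f ⟨n, firstObs Z n ω⟩) atTop (fun _ => a) := by
  rw [tendstoInMeasure_iff_dist]
  intro δ hδ
  obtain ⟨η, hη, h⟩ := eventually_momentFilter (Metric.tendsto_nhds.1 hf δ hδ)
  refine tendsto_of_tendsto_of_tendsto_of_le_of_le tendsto_const_nhds
    (tendsto_measure_momentError_ge_const hC hη) (fun _ => zero_le) fun n => ?_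
  refine measure_mono fun ω hω => ?_
  by_contra hcon
  exact absurd (h ⟨n, firstObs Z n ω⟩ (not_le.1 hcon)) (not_lt.2 hω)

theorem tendstoInMeasure_sqrt_mul_of_isBigO
    (hC : ∀ n : ℕ, 0 < n → ∀ ε : ℝ, 0 < ε → P {ω | ε ≤ momentError μ (firstObs Z n ω)} ≤
      ENNReal.ofReal (C / (n * ε ^ 2)))
    {f : (Σ n : ℕ, Fin n → Matrix (Fin p) (Fin q) ℝ) → ℝ}
    (hf : f =O[momentFilter μ] fun t => momentError μ t.2 ^ 2) :
    TendstoInMeasure P (fun (n : ℕ) ω => √(n : ℝ) * f ⟨n, firstObs Z n ω⟩) atTop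
      (fun _ => (0 : ℝ)) := by
  rw [tendstoInMeasure_iff_dist]
  intro δ hδ
  obtain ⟨K, hK, hb⟩ := hf.exists_pos
  obtain ⟨η, hη, h⟩ := eventually_momentFilter hb.bound
  have hlim1 := tendsto_measure_momentError_ge_const hC hη
  have hsqrt : ∀ n : ℕ, 0 < n → 0 < √(n : ℝ) := fun n hn =>
    Real.sqrt_pos.2 (by exact_mod_cast hn)
  have hlim2 := tendsto_measure_momentError_ge hC (ε := fun n => √(δ / (K * √(n : ℝ))))
    (fun n hn => Real.sqrt_pos.2 (div_pos hδ (mul_pos hK (hsqrt n hn)))) (by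
      have h1 : Tendsto (fun n : ℕ => √(n : ℝ) * (δ / K)) atTop atTop :=
        (Real.tendsto_sqrt_atTop.comp tendsto_natCast_atTop_atTop).atTop_mul_const (by positivity)
      refine h1.congr' ?_
      filter_upwards [eventually_gt_atTop 0] with n hn
      have h2 := hsqrt n hn
      have h3 : (n : ℝ) = √(n : ℝ) * √(n : ℝ) := (Real.mul_self_sqrt (by positivity)).symm
      rw [Real.sq_sqrt (by positivity)]
      calc √(n : ℝ) * (δ / K) = √(n : ℝ) * √(n : ℝ) * (δ / (K * √(n : ℝ))) := by field_simp
        _ = n * (δ / (K * √(n : ℝ))) := by rw [← h3])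
  have hsum := hlim1.add hlim2
  rw [add_zero] at hsum
  refine tendsto_of_tendsto_of_tendsto_of_le_of_le' tendsto_const_nhds hsum
    (Eventually.of_forall fun _ => zero_le) ?_
  filter_upwards [eventually_gt_atTop 0] with n hn
  refine (measure_mono fun ω hω => ?_).trans (measure_union_le _ _)
  by_contra hcon
  simp only [Set.mem_union, Set.mem_ofPred_eq, not_or, not_le] at hcon
  obtain ⟨hc1, hc2⟩ := hcon
  have h2 := hsqrt n hn
  have h3 : ‖f ⟨n, firstObs Z n ω⟩‖ ≤ K * ‖momentError μ (firstObs Z n ω) ^ 2‖ :=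
    h ⟨n, firstObs Z n ω⟩ hc1
  rw [Real.lt_sqrt (momentError_nonneg _ _)] at hc2
  rw [Real.norm_eq_abs, Real.norm_eq_abs, abs_of_nonneg (sq_nonneg (momentError _ _))] at h3
  have hω' : δ ≤ dist (√(n : ℝ) * f ⟨n, firstObs Z n ω⟩) 0 := hω
  rw [Real.dist_eq, sub_zero, abs_mul, abs_of_pos h2] at hω'
  rw [lt_div_iff₀ (by positivity)] at hc2
  nlinarith [mul_le_mul_of_nonneg_left h3 h2.le]

end Transfer

end MFOBI

theorem mainTheorem1 {Ω : Type*} [MeasurableSpace Ω] (P : Measure Ω) [IsProbabilityMeasure P]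
    (p q : ℕ) (hp : 0 < p) (hq : 0 < q)
    (Z : ℕ → Ω → Matrix (Fin p) (Fin q) ℝ)
    (hmeas : ∀ i, Measurable (Z i))
    (hindep : iIndepFun Z P)
    (hident : ∀ i, IdentDistrib (Z i) (Z 0) P P)
    (hmoment : ∀ k l, MemLp (fun ω => Z 0 ω k l) 8 P)
    (hstd : MFOBI.StandardizedIndependent P (Z 0))
    (hkurt : MFOBI.DistinctKurtoses P (Z 0))
    (N : Fin 2) (c : Bool) :
    Tendsto
        (fun n : ℕ => P {ω | (MFOBI.leftCov c (MFOBI.firstObs Z n ω)).PosDef ∧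
          (MFOBI.rightCov c (MFOBI.firstObs Z n ω)).PosDef})
        atTop (𝓝 1) ∧
    ∃ G : (n : ℕ) → (Fin n → Matrix (Fin p) (Fin q) ℝ) → Matrix (Fin p) (Fin p) ℝ,
      (∀ n, Measurable (G n)) ∧
      (∀ n x, (MFOBI.leftCov c x).PosDef → (MFOBI.rightCov c x).PosDef →
        MFOBI.IsLeftEstimate N c x (G n x)) ∧
      (∀ k k', TendstoInMeasure P (fun n ω => G n (MFOBI.firstObs Z n ω) k k') atTop
        (fun _ => (1 : Matrix (Fin p) (Fin p) ℝ) k k')) ∧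
      (∀ k, TendstoInMeasure P
        (fun (n : ℕ) ω =>
          √(n : ℝ) * (G n (MFOBI.firstObs Z n ω) k k - 1)
            - (-(1 / 2) * (√(n : ℝ) * (MFOBI.sBar (MFOBI.firstObs Z n ω) k k - 1))))
        atTop (fun _ => (0 : ℝ))) ∧
      (∀ k k', k ≠ k' → TendstoInMeasure P
        (fun (n : ℕ) ω =>
          √(n : ℝ) * G n (MFOBI.firstObs Z n ω) k k'
            - (√(n : ℝ) * MFOBI.QBar (MFOBI.skew P (Z 0)) (MFOBI.firstObs Z n ω) k k'
                + √(n : ℝ) * MFOBI.RBar N (MFOBI.firstObs Z n ω) k k'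
                - (MFOBI.rowKurt P (Z 0) k + MFOBI.bConst N p q)
                    * (√(n : ℝ) * MFOBI.sBar (MFOBI.firstObs Z n ω) k k'))
              / (MFOBI.rowKurt P (Z 0) k - MFOBI.rowKurt P (Z 0) k'))
        atTop (fun _ => (0 : ℝ))) := by
  obtain ⟨C, hC⟩ := MFOBI.exists_measure_momentError_ge hindep hident hmoment
  have hμ := hstd.hasStandardMoments (hmeas 0)
  have hM := MFOBI.momentsClose_momentFilter (MFOBI.popMoment P (Z 0))
  have he : Tendsto (fun t : Σ n : ℕ, Fin n → Matrix (Fin p) (Fin q) ℝ =>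
      MFOBI.momentError (MFOBI.popMoment P (Z 0)) t.2)
      (MFOBI.momentFilter (MFOBI.popMoment P (Z 0))) (𝓝 0) := tendsto_comap
  have hG := hM.leftEstimate_expansion hμ he hp hq N c (κ := MFOBI.rowKurt P (Z 0))
    (fun _ => rfl) hkurt.1
  refine ⟨?_, fun _ => MFOBI.leftEstimate N c, fun _ => MFOBI.measurable_leftEstimate N c,
    fun _ x => MFOBI.isLeftEstimate_leftEstimate N c x, fun k k' => ?_, fun k => ?_,
    fun k k' hk => ?_⟩
  · refine MFOBI.tendsto_measure_of_eventually hC (A := fun t =>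
      (MFOBI.leftCov c t.2).PosDef ∧ (MFOBI.rightCov c t.2).PosDef) ?_
    exact (MFOBI.eventually_posDef he (fun t => MFOBI.leftCov_transpose c t.2)
      fun i j => (hM.leftCov_expansion hμ he hq c i j).sub_const he).and
      (MFOBI.eventually_posDef he (fun t => MFOBI.rightCov_transpose c t.2)
        (hM.rightCov_sub_one hμ he hp c))
  · exact MFOBI.tendstoInMeasure_of_tendsto
      (f := fun t => MFOBI.leftEstimate N c t.2 k k') hC ((hG k k').tendsto he)
  · refine (MFOBI.tendstoInMeasure_sqrt_mul_of_isBigO hC (hG k k).remainder).congr_left fun n => ?_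
    refine Eventually.of_forall fun ω => ?_
    simp only [Matrix.one_apply_eq, if_true]
    ring
  · refine (MFOBI.tendstoInMeasure_sqrt_mul_of_isBigO hC (hG k k').remainder).congr_left
      fun n => ?_
    refine Eventually.of_forall fun ω => ?_
    simp only [Matrix.one_apply_ne hk, if_neg hk]
    ring
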